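/- Let $X$ be a countably infinite set. A weighted graph $G=(X,b,m)$ consists of a function $m\colon X\to(0,\infty)$, extended to a measure on all subsets of $X$ by additivity, and a function $b\colon X\times X\to[0,\infty)$ with $b(x,x)=0$, $b(x,y)=b(y,x)$ and $\sum_{y\in X}b(x,y)<\infty$ for all $x,y\in X$ (neither local finiteness nor connectedness is assumed). Let $\mathcal{L}f(x)=\frac{1}{m(x)}\sum_{y\in X}b(x,y)(f(x)-f(y))$. For a finite set $K\subseteq X$ let $L_K$ be the operator on the functions on $K$ that extends a function by $0$ to $X$, applies $\mathcal{L}$ and restricts the result to $K$; let $p^K_t(x,y)=e^{-tL_K}(1_y/m(y))(x)$ for $x,y\in K$ and $t\ge 0$, and let the heat kernel $p_t(x,y)=\lim_{K\uparrow X}p_t^K(x,y)$ be the limit along finite sets $K$ exhausting $X$. The graph $G$ is called stochastically complete if $\sum_{y\in X}p_t(x,y)m(y)=1$ for all $x\in X$ and all $t\ge 0$. An intrinsic metric of $G$ is a pseudo metric $\varrho\colon X\times X\to[0,\infty)$ with $\sum_{y\in X}b(x,y)\varrho^2(x,y)\le m(x)$ for all $x\in X$. **Theorem (volume growth and stochastic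 completeness).** Let $G=(X,b,m)$ be a weighted graph with an intrinsic metric $\varrho$ all of whose distance balls are finite sets. Fix $x_0\in X$, and for $r\ge 0$ let $V_\varrho(r)=m(\{x\in X : \varrho(x,x_0)\le r\})$. Let $\log^{\#}(v)=\max\{\log v,1\}$. If $$\int^\infty \frac{r}{\log^{\#}V_\varrho(r)}\,dr=\infty,$$ then $G$ is stochastically complete. -/

import Mathlib

open Filter MeasureTheory
open scoped ENNReal

noncomputable section

/-- A weighted graph over the vertex set `X`: a vertex measure `m : X → (0, ∞)` and an edge weight
`b : X × X → [0, ∞)` which vanishes on the diagonal, is symmetric and has finite vertex sums.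
Neither local finiteness nor connectedness is required. -/
structure WeightedGraph (X : Type*) where
  /-- the vertex measure, as a function on the vertices -/
  m : X → ℝ
  /-- the edge weight -/
  b : X → X → ℝ
  m_pos : ∀ x, 0 < m x
  b_nonneg : ∀ x y, 0 ≤ b x y
  b_diag : ∀ x, b x x = 0
  b_symm : ∀ x y, b x y = b y x
  b_summable : ∀ x, Summable (fun y => b x y)

namespace WeightedGraph

variable {X : Type*}

/-- The extension of the vertex measure to all subsets of `X` by countable additivity. -/
def measure (G : WeightedGraph X) (A : Set X) : ℝ≥0∞ :=
  ∑' x : A, ENNReal.ofReal (G.m x)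

/-- The formal Laplacian `𝓛 f (x) = (1 / m x) ∑_y b(x,y) (f x - f y)`. It is only applied to
finitely supported functions below, for which the series converges absolutely. -/
def formalLaplacian (G : WeightedGraph X) (f : X → ℝ) (x : X) : ℝ :=
  (1 / G.m x) * ∑' y, G.b x y * (f x - f y)

open Classical in
/-- The matrix, in the basis `(1_y)_{y ∈ K}` of `C(K)`, of the restriction `L_K` of the formal
Laplacian to the finite set `K`: a function on `K` is extended by zero to `X`, the formal
Laplacian is applied, and the result is restricted to `K`. -/
def restrictedLaplacian (G : WeightedGraph X) (K : Finset X) : Matrix K K ℝ :=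
  Matrix.of fun x y => G.formalLaplacian (Pi.single (y : X) 1) x

open Classical in
/-- The restricted heat kernel `p_t^K(x,y) = (e^{-t L_K} (1_y / m y)) (x)` for `x, y ∈ K`, extended
by zero to all `x, y ∈ X`. -/
def restrictedHeatKernel (G : WeightedGraph X) (K : Finset X) (t : ℝ) (x y : X) : ℝ :=
  if h : x ∈ K ∧ y ∈ K then
    (NormedSpace.exp ((-t) • G.restrictedLaplacian K)).mulVec
      (Pi.single (⟨y, h.2⟩ : K) (1 / G.m y)) ⟨x, h.1⟩
  else 0

/-- The heat kernel `p_t(x,y)`: the limit of the restricted heat kernels as the finite set `K`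
exhausts `X`. The restricted heat kernels are monotone in `K` and bounded by `1 / m y` for `t ≥ 0`,
so that the limit along the directed set of all finite subsets exists, and it is the limit along
any exhaustion of `X` (or of the connected component of `x`) by finite sets. -/
def heatKernel (G : WeightedGraph X) (t : ℝ) (x y : X) : ℝ :=
  limUnder (atTop : Filter (Finset X)) (fun K => G.restrictedHeatKernel K t x y)

/-- Stochastic completeness: `∑_y p_t(x,y) m(y) = 1` for all `x ∈ X` and all `t ≥ 0`. -/
def StochasticallyComplete (G : WeightedGraph X) : Prop :=
  ∀ x : X, ∀ t : ℝ, 0 ≤ t → HasSum (fun y => G.heatKernel t x y * G.m y) 1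

/-- A pseudo metric `ϱ : X × X → [0, ∞)` is an intrinsic metric of the weighted graph if
`∑_y b(x,y) ϱ(x,y)² ≤ m(x)` for all `x` (in particular, these series converge). -/
structure IsIntrinsicMetric (G : WeightedGraph X) (ϱ : X → X → ℝ) : Prop where
  nonneg : ∀ x y, 0 ≤ ϱ x y
  self_eq_zero : ∀ x, ϱ x x = 0
  symm : ∀ x y, ϱ x y = ϱ y x
  triangle : ∀ x y z, ϱ x z ≤ ϱ x y + ϱ y z
  summable : ∀ x, Summable (fun y => G.b x y * ϱ x y ^ 2)
  tsum_le : ∀ x, ∑' y, G.b x y * ϱ x y ^ 2 ≤ G.m x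

/-- The ball of radius `r` around `x₀` with respect to `ϱ`. -/
def ball (ϱ : X → X → ℝ) (x₀ : X) (r : ℝ) : Set X :=
  {x | ϱ x x₀ ≤ r}

/-- The volume `V_ϱ(r)` of the ball of radius `r` around `x₀`, as a real number (the measure is
finite whenever the ball is a finite set). -/
def volumeGrowth (G : WeightedGraph X) (ϱ : X → X → ℝ) (x₀ : X) (r : ℝ) : ℝ :=
  (G.measure (ball ϱ x₀ r)).toReal

/-- `log^# = max {log, 1}`. -/
def logSharp (v : ℝ) : ℝ :=
  max (Real.log v) 1

end WeightedGraph

end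

/-! Stochastic completeness reduces to a Liouville property: every `u` with values in `[0,1]` and `∑
b(x,y)(u y - u x) = m x * u x` is zero. On a finite set the defect `1 - e^{-tL}1` is at most `e^t (1
- f)` with `L f + f = 1`. The function `1 - f`, continued by one, solves this equation on the set,
and limits of such functions along finite sets are global solutions
(`exists_resolvent_le_semigroup`, `exists_small_resolvent_solution`).

If `u` is nonzero with supremum `S`, then `U = 4 (u - S) / S` is nonpositive and, where `U > -1`,
satisfies `2 m x ≤ ∑ c(x,y)(U y - U x)`, with `c` the weight of the edges of length at most one: the
intrinsic metric bounds the loss from discarding long edges (`eq_zero_of_resolvent`). It remains to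
show `U ≤ -1`, which contradicts the supremum of `U` being zero.

Think of `U + t` as a subsolution of the heat equation whose positive part vanishes at `t = 0`; the
claim is that it still vanishes at `t = 1`, in the manner of Täcklind and Grigor'yan. Gaussian
weights need a chain rule that differences do not obey, so `U` is extended to the edges of a metric
graph, where an edge has length `ϱ x y`, by a profile of second derivative 2 in arc length. Of the
bound `2 m x`, one half pays for the mass at the vertex, the other for the flux of the bent profiles
(`sum_flux_nonpos`).

A Gaussian weight whose decay rate grows with time is a supersolution (`gaussianWeight_inequality`).
Cutting it off outside radius `3R` costs `exp(-R²/4δ) V(9R)` over a time `δ`, which is at most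
`8/R²` if `δ ≤ min(1, R²/(8 log# V(9R)))`. Stepping back in time while passing from radius `R = 3^j`
to `3^{j+1}`, the admissible steps have divergent sum by the volume hypothesis, so time zero is
reached after finitely many steps (`energy_le_of_le_sum`). The energy at time one within radius
`3^j` is therefore `O(4^{-j})`, hence `U + 1 ≤ 0`. -/

namespace Matrix

/-! ### Matrix exponentials and submarkovian semigroups -/

section Exponential

variable {n n' : Type*} [Fintype n] [DecidableEq n] [Fintype n'] [DecidableEq n']

theorem hasSum_exp_apply (A : Matrix n n ℝ) (i j : n) :
    HasSum (fun k : ℕ => ((k.factorial : ℝ)⁻¹) * (A ^ k) i j) (NormedSpace.exp A i j) := by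
  let _ : NormedRing (Matrix n n ℝ) := Matrix.linftyOpNormedRing
  let _ : NormedAlgebra ℝ (Matrix n n ℝ) := Matrix.linftyOpNormedAlgebra
  have h := NormedSpace.exp_series_hasSum_exp' (𝕂 := ℝ) A
  have h1 := (Pi.hasSum.1 h) i
  exact (Pi.hasSum.1 h1) j

theorem exp_add_smul_one (A : Matrix n n ℝ) (c : ℝ) :
    NormedSpace.exp (A + c • (1 : Matrix n n ℝ)) = Real.exp c • NormedSpace.exp A := by
  rw [Matrix.exp_add_of_commute _ _ ((Commute.one_right A).smul_right c)]
  have : NormedSpace.exp (c • (1 : Matrix n n ℝ)) = Real.exp c • 1 := by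
    rw [smul_one_eq_diagonal, Matrix.exp_diagonal, smul_one_eq_diagonal]
    congr 1
    ext i
    rw [Pi.coe_exp, Real.exp_eq_exp_ℝ]
  rw [this, mul_smul_comm, mul_one]

/-- Entrywise comparison of exponentials of a Metzler matrix and of a principal submatrix. -/
theorem exp_apply_le_exp_apply (A : Matrix n n ℝ) (A' : Matrix n' n' ℝ) (e : n ↪ n')
    (hA : ∀ i j, A i j = A' (e i) (e j)) (hoff : ∀ i j, i ≠ j → 0 ≤ A' i j) (i j : n) :
    0 ≤ NormedSpace.exp A i j ∧ NormedSpace.exp A i j ≤ NormedSpace.exp A' (e i) (e j) := by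
  -- Adding `c` times the identity makes the larger matrix entrywise nonnegative and multiplies both
  -- exponentials by `e^c`, so it suffices to compare powers term by term.
  obtain ⟨c, hc⟩ : ∃ c : ℝ, ∀ i, 0 ≤ A' i i + c := by
    refine ⟨∑ i, |A' i i|, fun i => ?_⟩
    have := Finset.single_le_sum (f := fun i => |A' i i|) (fun i _ => abs_nonneg _)
      (Finset.mem_univ i)
    have h2 := neg_abs_le (A' i i)

    linarith
  set B := A + c • (1 : Matrix n n ℝ) with hB
  set B' := A' + c • (1 : Matrix n' n' ℝ) with hB'
  have hB'0 : ∀ i j, 0 ≤ B' i j := by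
    intro i j
    by_cases h : i = j
    · subst h; simpa [hB'] using hc i
    · simpa [hB', Matrix.one_apply, h] using hoff i j h
  have hBB : ∀ i j, B i j = B' (e i) (e j) := by
    intro i j
    simp [hB, hB', hA, Matrix.one_apply]
  have hpow' : ∀ k : ℕ, ∀ i j, 0 ≤ (B' ^ k) i j := by
    intro k
    induction k with
    | zero => intro i j; simp only [pow_zero, Matrix.one_apply]; split_ifs <;> norm_num
    | succ k ih =>
      intro i j
      rw [pow_succ, Matrix.mul_apply]
      exact Finset.sum_nonneg fun l _ => mul_nonneg (ih _ _) (hB'0 _ _)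
  have hpow : ∀ k : ℕ, ∀ i j, 0 ≤ (B ^ k) i j ∧ (B ^ k) i j ≤ (B' ^ k) (e i) (e j) := by
    intro k
    induction k with
    | zero =>
      intro i j
      simp only [pow_zero, Matrix.one_apply, e.injective.eq_iff, le_refl, and_true]
      split_ifs <;> norm_num
    | succ k ih =>
      intro i j
      rw [pow_succ, Matrix.mul_apply, pow_succ, Matrix.mul_apply]
      refine ⟨Finset.sum_nonneg fun l _ => mul_nonneg (ih _ _).1 (hBB _ _ ▸ hB'0 _ _), ?_⟩
      calc ∑ l, (B ^ k) i l * B l j ≤ ∑ l, (B' ^ k) (e i) (e l) * B' (e l) (e j) := by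
            refine Finset.sum_le_sum fun l _ => ?_
            rw [hBB l j]
            exact mul_le_mul_of_nonneg_right (ih i l).2 (hB'0 _ _)
        _ = ∑ l ∈ Finset.univ.map e, (B' ^ k) (e i) l * B' l (e j) := by
            rw [Finset.sum_map]
        _ ≤ _ := Finset.sum_le_sum_of_subset_of_nonneg (Finset.subset_univ _)
            fun l _ _ => mul_nonneg (hpow' _ _ _) (hB'0 _ _)
  have e1 : NormedSpace.exp B i j = Real.exp c * NormedSpace.exp A i j := by
    rw [hB, exp_add_smul_one]; rfl
  have e2 : NormedSpace.exp B' (e i) (e j) = Real.exp c * NormedSpace.exp A' (e i) (e j) := by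
    rw [hB', exp_add_smul_one]; rfl
  have h1 : 0 ≤ NormedSpace.exp B i j :=
    (hasSum_exp_apply B i j).nonneg fun k => mul_nonneg (by positivity) (hpow k i j).1
  have h2 : NormedSpace.exp B i j ≤ NormedSpace.exp B' (e i) (e j) :=
    hasSum_le (fun k => mul_le_mul_of_nonneg_left (hpow k i j).2 (by positivity))
      (hasSum_exp_apply B i j) (hasSum_exp_apply B' (e i) (e j))
  rw [e1] at h1 h2
  rw [e2] at h2
  exact ⟨nonneg_of_mul_nonneg_right h1 (Real.exp_pos c),
    le_of_mul_le_mul_left h2 (Real.exp_pos c)⟩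

theorem hasDerivAt_exp_smul_mulVec (A : Matrix n n ℝ) (v : n → ℝ) (i : n) (s : ℝ) :
    HasDerivAt (fun s : ℝ => (NormedSpace.exp (s • A) *ᵥ v) i)
      ((NormedSpace.exp (s • A) *ᵥ (A *ᵥ v)) i) s := by
  let _ : NormedRing (Matrix n n ℝ) := Matrix.linftyOpNormedRing
  let _ : NormedAlgebra ℝ (Matrix n n ℝ) := Matrix.linftyOpNormedAlgebra
  have h := hasDerivAt_exp_smul_const (𝕂 := ℝ) A s
  let φ : Matrix n n ℝ →ₗ[ℝ] ℝ :=
    { toFun := fun M => (M *ᵥ v) i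
      map_add' := fun M N => by simp [Matrix.add_mulVec]
      map_smul' := fun c M => by simp [Matrix.smul_mulVec] }
  have h2 := (LinearMap.toContinuousLinearMap φ).hasFDerivAt.comp_hasDerivAt s h
  rw [Matrix.mulVec_mulVec]
  exact h2

/-- The comparison of the semigroup of a submarkovian generator with its resolvent. -/
theorem exists_resolvent_le_semigroup (L : Matrix n n ℝ) (hoff : ∀ i j, i ≠ j → L i j ≤ 0)
    (hrow : ∀ i, 0 ≤ ∑ j, L i j) :
    (∀ t : ℝ, 0 ≤ t → ∀ i, (NormedSpace.exp ((-t) • L) *ᵥ 1) i ≤ 1) ∧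
    ∃ f : n → ℝ, (∀ i, 0 ≤ f i) ∧ (∀ i, f i ≤ 1) ∧ (L *ᵥ f + f = 1) ∧
      ∀ t : ℝ, 0 ≤ t → ∀ i,
        1 - (NormedSpace.exp ((-t) • L) *ᵥ 1) i ≤ Real.exp t * (1 - f i) := by
  have hexp : ∀ t : ℝ, 0 ≤ t → ∀ i j, 0 ≤ NormedSpace.exp ((-t) • L) i j := by
    intro t ht i j
    refine (exp_apply_le_exp_apply ((-t) • L) ((-t) • L) (Function.Embedding.refl n)
      (fun _ _ => rfl) (fun i j hij => ?_) i j).1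
    rw [Matrix.smul_apply, smul_eq_mul]
    nlinarith [hoff i j hij]
  have hpos : ∀ t : ℝ, 0 ≤ t → ∀ v : n → ℝ, (∀ i, 0 ≤ v i) → ∀ i,
      0 ≤ (NormedSpace.exp ((-t) • L) *ᵥ v) i := fun t ht v hv i =>
    Finset.sum_nonneg fun j _ => mul_nonneg (hexp t ht i j) (hv j)
  have hκ : ∀ i, 0 ≤ (L *ᵥ 1) i := fun i => by
    simpa [Matrix.mulVec, dotProduct] using hrow i
  -- Minimum principle: at a negative minimum `L f` is nonpositive, so `L f + f` would be negative.
  -- It gives the bounds on `f` and, applied to `v` and `-v`, solvability.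
  have hmin : ∀ f : n → ℝ, (∀ i, 0 ≤ (L *ᵥ f + f) i) → ∀ i, 0 ≤ f i := by
    intro f hf i
    have : Nonempty n := ⟨i⟩
    obtain ⟨i0, hi0⟩ := Finite.exists_min f
    by_contra! hneg
    have hneg0 : f i0 < 0 := lt_of_le_of_lt (hi0 i) hneg
    have h1 : (L *ᵥ f) i0 = ∑ j, L i0 j * (f j - f i0) + f i0 * ∑ j, L i0 j := by
      rw [Finset.mul_sum, ← Finset.sum_add_distrib]
      exact Finset.sum_congr rfl fun j _ => by ring
    have h2 : ∑ j, L i0 j * (f j - f i0) ≤ 0 := by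
      refine Finset.sum_nonpos fun j _ => ?_
      by_cases h : i0 = j
      · subst h; simp
      · exact mul_nonpos_of_nonpos_of_nonneg (hoff _ _ h) (sub_nonneg.2 (hi0 j))
    have h3 : f i0 * ∑ j, L i0 j ≤ 0 := mul_nonpos_of_nonpos_of_nonneg hneg0.le (hrow i0)
    have h4 := hf i0
    simp only [Pi.add_apply] at h4
    linarith
  obtain ⟨f, hf⟩ : ∃ f : n → ℝ, L *ᵥ f + f = 1 := by
    have hinj : Function.Injective (L.mulVecLin + (LinearMap.id : (n → ℝ) →ₗ[ℝ] (n → ℝ))) := by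
      rw [injective_iff_map_eq_zero]
      intro v hv
      have hv' : L *ᵥ v + v = 0 := by simpa using hv
      have h1 := hmin v (fun i => by rw [hv']; simp)
      have h2 := hmin (-v) (fun i => by
        rw [Matrix.mulVec_neg, ← neg_add, hv']; simp)
      ext i
      have := h1 i
      have := h2 i
      simp only [Pi.neg_apply, Pi.zero_apply] at *
      linarith
    obtain ⟨f, hf⟩ := LinearMap.injective_iff_surjective.1 hinj 1
    exact ⟨f, by simpa using hf⟩
  have hderiv : ∀ (t s : ℝ) (v : n → ℝ) (i : n),
      HasDerivAt (fun s : ℝ => (NormedSpace.exp ((-(t - s)) • L) *ᵥ v) i)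
        ((NormedSpace.exp ((-(t - s)) • L) *ᵥ (L *ᵥ v)) i) s := by
    intro t s v i
    have h1 := hasDerivAt_exp_smul_mulVec L v i (-(t - s))
    have h2 : HasDerivAt (fun s : ℝ => -(t - s)) 1 s := by
      simp only [neg_sub]
      exact (hasDerivAt_id s).sub_const t
    have := HasDerivAt.comp s h1 h2
    rw [mul_one] at this
    exact this
  have hf1 : ∀ i, 0 ≤ (1 - f) i := by
    refine hmin _ fun i => ?_
    rw [Matrix.mulVec_sub, sub_add_sub_comm, hf]
    simpa using hκ i
  refine ⟨fun t ht i => ?_, f, hmin f (fun i => by rw [hf]; simp), fun i => ?_, hf,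
    fun t ht i => ?_⟩
  · have hm : MonotoneOn (fun s : ℝ => (NormedSpace.exp ((-(t - s)) • L) *ᵥ 1) i)
        (Set.Icc 0 t) := by
      refine monotoneOn_of_deriv_nonneg (convex_Icc 0 t)
        (fun s _ => (hderiv t s 1 i).continuousAt.continuousWithinAt)
        (fun s _ => (hderiv t s 1 i).differentiableAt.differentiableWithinAt) fun s hs => ?_
      rw [interior_Icc] at hs
      rw [(hderiv t s 1 i).deriv]
      exact hpos _ (by linarith [hs.2]) _ hκ i
    have := hm (Set.left_mem_Icc.2 ht) (Set.right_mem_Icc.2 ht) ht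
    simpa using this
  · have := hf1 i
    simp only [Pi.sub_apply, Pi.one_apply] at this
    linarith
  · have hg : ∀ s : ℝ, HasDerivAt (fun s : ℝ =>
        Real.exp s * (NormedSpace.exp ((-(t - s)) • L) *ᵥ (1 - f)) i
          - (NormedSpace.exp ((-(t - s)) • L) *ᵥ 1) i)
        (Real.exp s * (NormedSpace.exp ((-(t - s)) • L) *ᵥ (1 - f)) i
          + Real.exp s * (NormedSpace.exp ((-(t - s)) • L) *ᵥ (L *ᵥ (1 - f))) i
          - (NormedSpace.exp ((-(t - s)) • L) *ᵥ (L *ᵥ 1)) i) s := fun s =>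
      ((Real.hasDerivAt_exp s).mul (hderiv t s (1 - f) i)).sub (hderiv t s 1 i)
    -- Duhamel interpolation: since `L (1 - f) = L 1 - (1 - f)`, the derivative equals `(e^s - 1)
    -- e^{-(t-s)L} (L 1)`, which is nonnegative.
    have hm : MonotoneOn (fun s : ℝ =>
        Real.exp s * (NormedSpace.exp ((-(t - s)) • L) *ᵥ (1 - f)) i
          - (NormedSpace.exp ((-(t - s)) • L) *ᵥ 1) i) (Set.Icc 0 t) := by
      refine monotoneOn_of_deriv_nonneg (convex_Icc 0 t)
        (fun s _ => (hg s).continuousAt.continuousWithinAt)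
        (fun s _ => (hg s).differentiableAt.differentiableWithinAt) fun s hs => ?_
      rw [interior_Icc] at hs
      rw [(hg s).deriv]
      have e1 : L *ᵥ (1 - f) = L *ᵥ 1 - (1 - f) := by
        rw [Matrix.mulVec_sub]
        have : L *ᵥ f = 1 - f := by rw [← hf]; abel
        rw [this]
      rw [e1, Matrix.mulVec_sub (NormedSpace.exp ((-(t - s)) • L)) (L *ᵥ 1)]
      have h1 := hpos (t - s) (by linarith [hs.2]) _ hκ i
      have h2 : 1 ≤ Real.exp s := Real.one_le_exp hs.1.le
      simp only [Pi.sub_apply]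
      nlinarith
    have h0 := hm (Set.left_mem_Icc.2 ht) (Set.right_mem_Icc.2 ht) ht
    have h1 := hpos t ht _ hf1 i
    simp only [Real.exp_zero, sub_zero, sub_self, neg_zero, zero_smul, NormedSpace.exp_zero,
      Matrix.one_mulVec, Pi.sub_apply, Pi.one_apply, one_mul] at h0 h1
    linarith

end Exponential

end Matrix

/-! ### Heat kernels of finite sets and the Liouville criterion -/

namespace WeightedGraph

open scoped Topology

variable {X : Type*}

open Classical in
theorem restrictedLaplacian_apply (G : WeightedGraph X) (K : Finset X) (x y : K) :
    G.restrictedLaplacian K x y =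
      (1 / G.m x) * ((if x = y then ∑' z, G.b x z else 0) - G.b x y) := by
  have h1 : ∀ z, G.b x z * ((Pi.single (y : X) (1 : ℝ) : X → ℝ) x - (Pi.single (y : X) (1 : ℝ) : X → ℝ) z)
      = G.b x z * (if x = y then 1 else 0) - (if z = (y : X) then G.b x y else 0) := by
    intro z
    simp only [Pi.single_apply, mul_sub, Subtype.ext_iff]
    congr 1
    by_cases h : z = (y : X)
    · simp [h]
    · simp [h]
  have h2 : Summable fun z : X => if z = (y : X) then G.b x y else 0 :=
    (hasSum_ite_eq (y : X) (G.b x y)).summable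
  simp only [restrictedLaplacian, Matrix.of_apply, formalLaplacian]
  rw [tsum_congr h1, ((G.b_summable x).mul_right _).tsum_sub h2, tsum_mul_right, tsum_ite_eq]
  simp

theorem restrictedLaplacian_nonpos (G : WeightedGraph X) (K : Finset X) (x y : K) (h : x ≠ y) :
    G.restrictedLaplacian K x y ≤ 0 := by
  rw [restrictedLaplacian_apply, if_neg h, zero_sub, mul_neg, neg_nonpos]
  exact mul_nonneg (one_div_nonneg.2 (G.m_pos _).le) (G.b_nonneg _ _)

theorem sum_restrictedLaplacian_mul (G : WeightedGraph X) (K : Finset X) (f : K → ℝ) (x : K) :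
    ∑ y, G.restrictedLaplacian K x y * f y =
      (1 / G.m x) * ((∑' z, G.b x z) * f x - ∑ y : K, G.b x y * f y) := by
  classical
  have h : ∀ y : K, G.restrictedLaplacian K x y * f y =
      (1 / G.m x) * ((if x = y then (∑' z, G.b x z) * f x else 0) - G.b x y * f y) := by
    intro y
    rw [restrictedLaplacian_apply]
    split_ifs with hxy
    · subst hxy; ring
    · ring
  rw [Finset.sum_congr rfl fun y _ => h y, ← Finset.mul_sum, Finset.sum_sub_distrib]
  simp

theorem sum_restrictedLaplacian_nonneg (G : WeightedGraph X) (K : Finset X) (x : K) :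
    0 ≤ ∑ y, G.restrictedLaplacian K x y := by
  have h := G.sum_restrictedLaplacian_mul K (fun _ => 1) x
  simp only [mul_one] at h
  rw [h, Finset.sum_coe_sort K (fun y => G.b x y)]
  exact mul_nonneg (one_div_nonneg.2 (G.m_pos _).le)
    (sub_nonneg.2 ((G.b_summable x).sum_le_tsum K fun y _ => G.b_nonneg _ _))

open Classical in
theorem restrictedHeatKernel_mul (G : WeightedGraph X) (K : Finset X) (t : ℝ) (x y : K) :
    G.restrictedHeatKernel K t x y * G.m y =
      NormedSpace.exp ((-t) • G.restrictedLaplacian K) x y := by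
  have hm := (G.m_pos y).ne'
  rw [restrictedHeatKernel, dif_pos ⟨x.2, y.2⟩]
  simp only [Subtype.coe_eta, Matrix.mulVec_single, MulOpposite.op_div, MulOpposite.op_one,
    Pi.smul_apply, Matrix.col_apply]
  simp [hm]

/-- The matrix of the smaller set is a principal submatrix of that of the larger one, and `-t L` has
nonnegative off-diagonal entries. -/
theorem restrictedHeatKernel_mul_mono (G : WeightedGraph X) {t : ℝ} (ht : 0 ≤ t) (x y : X) :
    Monotone fun K => G.restrictedHeatKernel K t x y * G.m y := by
  classical
  intro K K' hK
  simp only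
  have key : ∀ (K K' : Finset X) (hK : K ⊆ K') (x y : K),
      0 ≤ NormedSpace.exp ((-t) • G.restrictedLaplacian K) x y ∧
      NormedSpace.exp ((-t) • G.restrictedLaplacian K) x y ≤
        NormedSpace.exp ((-t) • G.restrictedLaplacian K') ⟨x, hK x.2⟩ ⟨y, hK y.2⟩ := by
    intro K K' hK x y
    let e : K ↪ K' := ⟨fun i => ⟨i, hK i.2⟩, fun i j hij =>
      Subtype.ext (congrArg (fun z : K' => (z : X)) hij)⟩
    have he : ∀ i, (e i : X) = i := fun _ => rfl
    refine Matrix.exp_apply_le_exp_apply _ _ e ?_ ?_ x y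
    · intro i j
      simp only [Matrix.smul_apply, smul_eq_mul, restrictedLaplacian_apply, he,
        e.injective.eq_iff]
    · intro i j hij
      rw [Matrix.smul_apply, smul_eq_mul]
      nlinarith [G.restrictedLaplacian_nonpos K' i j hij]
  by_cases h : x ∈ K ∧ y ∈ K
  · have h1 := G.restrictedHeatKernel_mul K t ⟨x, h.1⟩ ⟨y, h.2⟩
    have h2 := G.restrictedHeatKernel_mul K' t ⟨x, hK h.1⟩ ⟨y, hK h.2⟩
    simp only at h1 h2
    rw [h1, h2]
    exact (key K K' hK ⟨x, h.1⟩ ⟨y, h.2⟩).2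
  · rw [restrictedHeatKernel, dif_neg h, zero_mul]
    by_cases h' : x ∈ K' ∧ y ∈ K'
    · have h2 := G.restrictedHeatKernel_mul K' t ⟨x, h'.1⟩ ⟨y, h'.2⟩
      simp only at h2
      rw [h2]
      exact (key K' K' (Finset.Subset.refl _) ⟨x, h'.1⟩ ⟨y, h'.2⟩).1
    · rw [restrictedHeatKernel, dif_neg h', zero_mul]

theorem sum_restrictedHeatKernel_mul (G : WeightedGraph X) [DecidableEq X] (K : Finset X) (t : ℝ)
    (x : K) :
    ∑ y ∈ K, G.restrictedHeatKernel K t x y * G.m y =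
      (NormedSpace.exp ((-t) • G.restrictedLaplacian K)).mulVec 1 x := by
  classical
  rw [← Finset.sum_coe_sort]
  simp only [Matrix.mulVec, dotProduct, Pi.one_apply, mul_one]
  refine Finset.sum_congr rfl fun y _ => ?_
  rw [restrictedHeatKernel_mul]
  congr!

/-- Solutions of the resolvent equation on a finite set with boundary value one dominate the
defect of the heat semigroup of this set. -/
theorem exists_resolvent_solution (G : WeightedGraph X) (K : Finset X) :
    (∀ t : ℝ, 0 ≤ t → ∀ x ∈ K, ∑ y ∈ K, G.restrictedHeatKernel K t x y * G.m y ≤ 1) ∧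
    ∃ u : X → ℝ, (∀ x, 0 ≤ u x) ∧ (∀ x, u x ≤ 1) ∧
      (∀ x ∈ K, ∑' y, G.b x y * (u y - u x) = G.m x * u x) ∧
      ∀ t : ℝ, 0 ≤ t → ∀ x ∈ K,
        1 - ∑ y ∈ K, G.restrictedHeatKernel K t x y * G.m y ≤ Real.exp t * u x := by
  classical
  obtain ⟨h1, f, hf0, hf1, hLf, hcomp⟩ := Matrix.exists_resolvent_le_semigroup
    (G.restrictedLaplacian K) (G.restrictedLaplacian_nonpos K) (G.sum_restrictedLaplacian_nonneg K)
  refine ⟨fun t ht x hx => ?_, fun x => 1 - if h : x ∈ K then f ⟨x, h⟩ else 0, fun x => ?_,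
    fun x => ?_, fun x hx => ?_, fun t ht x hx => ?_⟩
  · have := G.sum_restrictedHeatKernel_mul K t ⟨x, hx⟩
    simp only at this
    rw [this]
    exact h1 t ht ⟨x, hx⟩
  · simp only
    split_ifs
    · linarith [hf1 ⟨x, ‹_›⟩]
    · simp
  · simp only
    split_ifs
    · linarith [hf0 ⟨x, ‹_›⟩]
    · simp
  · have e1 := congrFun hLf ⟨x, hx⟩
    simp only [Pi.add_apply, Pi.one_apply, Matrix.mulVec, dotProduct] at e1
    rw [G.sum_restrictedLaplacian_mul K f ⟨x, hx⟩] at e1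
    simp only at e1
    have hm := G.m_pos x
    have e2 : ∀ y, G.b x y * ((1 - if h : y ∈ K then f ⟨y, h⟩ else 0) -
        (1 - if h : x ∈ K then f ⟨x, h⟩ else 0)) =
        G.b x y * f ⟨x, hx⟩ - G.b x y * (if h : y ∈ K then f ⟨y, h⟩ else 0) := by
      intro y
      rw [dif_pos hx]
      ring
    have e3 : ∀ y ∉ K, G.b x y * (if h : y ∈ K then f ⟨y, h⟩ else 0) = 0 := by
      intro y hy
      rw [dif_neg hy, mul_zero]
    rw [tsum_congr e2, ((G.b_summable x).mul_right _).tsum_sub (summable_of_ne_finset_zero e3),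
      tsum_mul_right, tsum_eq_sum e3, ← Finset.sum_coe_sort]
    have e4 : ∀ y : K, G.b x y * (if h : (y : X) ∈ K then f ⟨y, h⟩ else 0) = G.b x y * f y := by
      intro y
      rw [dif_pos y.2]
    rw [Finset.sum_congr rfl fun y _ => e4 y]
    simp only [dif_pos hx]
    field_simp at e1
    linarith
  · have := G.sum_restrictedHeatKernel_mul K t ⟨x, hx⟩
    simp only at this
    simp only [this, dif_pos hx]
    exact hcomp t ht ⟨x, hx⟩

/-- Limits of resolvent solutions on finite sets are global bounded solutions. -/
theorem exists_small_resolvent_solution (G : WeightedGraph X)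
    (hG : ∀ u : X → ℝ, (∀ x, 0 ≤ u x) → (∀ x, u x ≤ 1) →
      (∀ x, ∑' y, G.b x y * (u y - u x) = G.m x * u x) → ∀ x, u x = 0)
    (U : Finset X → X → ℝ) (hU0 : ∀ K x, 0 ≤ U K x) (hU1 : ∀ K x, U K x ≤ 1)
    (hU : ∀ K, ∀ x ∈ K, ∑' y, G.b x y * (U K y - U K x) = G.m x * U K x)
    (x : X) {ε : ℝ} (hε : 0 < ε) : ∃ K, x ∈ K ∧ U K x < ε := by
  by_contra! hcon
  -- An ultrafilter gives simultaneous pointwise limits of the `[0,1]`-valued solutions without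
  -- extracting subsequences; the summable `b y` dominates the series in the equation.
  let 𝒰 : Ultrafilter (Finset X) := Ultrafilter.of atTop
  have hle : (𝒰 : Filter (Finset X)) ≤ atTop := Ultrafilter.of_le atTop
  have hmem : ∀ y : X, ∀ᶠ K in (𝒰 : Filter (Finset X)), y ∈ K := fun y =>
    hle ((eventually_ge_atTop {y}).mono fun K hK => hK (Finset.mem_singleton_self y))
  have hlim : ∀ y : X, ∃ l ∈ Set.Icc (0 : ℝ) 1,
      Tendsto (fun K => U K y) (𝒰 : Filter (Finset X)) (𝓝 l) := by
    intro y
    obtain ⟨l, hl, h⟩ := isCompact_Icc.ultrafilter_le_nhds (𝒰.map fun K => U K y)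
      (s := Set.Icc (0 : ℝ) 1) (le_principal_iff.2 (mem_map.2 (univ_mem' fun K => ⟨hU0 K y, hU1 K y⟩)))
    exact ⟨l, hl, h⟩
  choose u hu hlim using hlim
  have hu0 := hG u (fun y => (hu y).1) (fun y => (hu y).2) (fun y => ?_) x
  · have : ε ≤ u x := ge_of_tendsto (hlim x) ((hmem x).mono fun K hK => hcon K hK)
    linarith
  · have h1 : Tendsto (fun K => ∑' z, G.b y z * (U K z - U K y)) (𝒰 : Filter (Finset X))
        (𝓝 (∑' z, G.b y z * (u z - u y))) := by
      refine tendsto_tsum_of_dominated_convergence (G.b_summable y)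
        (fun z => ((hlim z).sub (hlim y)).const_mul _) (Eventually.of_forall fun K z => ?_)
      rw [Real.norm_eq_abs, abs_mul, abs_of_nonneg (G.b_nonneg y z)]
      refine mul_le_of_le_one_right (G.b_nonneg y z) (abs_le.2 ⟨?_, ?_⟩) <;>
        linarith [hU0 K z, hU0 K y, hU1 K z, hU1 K y]
    have h2 : Tendsto (fun K => ∑' z, G.b y z * (U K z - U K y)) (𝒰 : Filter (Finset X))
        (𝓝 (G.m y * u y)) :=
      ((hlim y).const_mul (G.m y)).congr' ((hmem y).mono fun K hK => (hU K y hK).symm)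
    exact tendsto_nhds_unique h1 h2

/-- The Liouville criterion for stochastic completeness. -/
theorem stochasticallyComplete_of_liouville (G : WeightedGraph X)
    (hG : ∀ u : X → ℝ, (∀ x, 0 ≤ u x) → (∀ x, u x ≤ 1) →
      (∀ x, ∑' y, G.b x y * (u y - u x) = G.m x * u x) → ∀ x, u x = 0) :
    G.StochasticallyComplete := by
  classical
  intro x t ht
  choose hmass U hU0 hU1 hU hcomp using fun K => G.exists_resolvent_solution K
  set P : Finset X → X → ℝ := fun K y => G.restrictedHeatKernel K t x y * G.m y with hP
  have hmono : ∀ y, Monotone fun K => P K y := G.restrictedHeatKernel_mul_mono ht x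
  have hempty : ∀ y, P ∅ y = 0 := fun y => by simp [hP, restrictedHeatKernel]
  have hP0 : ∀ K y, 0 ≤ P K y := fun K y => (hempty y).symm.le.trans (hmono y (Finset.empty_subset K))
  have hsum : ∀ F K : Finset X, ∑ y ∈ F, P K y ≤ 1 := by
    intro F K
    -- The mass bound is available only for a sum over the same set that defines the kernel and
    -- contains `x`.
    set K' := insert x (F ∪ K)
    calc ∑ y ∈ F, P K y ≤ ∑ y ∈ F, P K' y := Finset.sum_le_sum fun y _ => hmono y
            (Finset.subset_union_right.trans (Finset.subset_insert _ _))
      _ ≤ ∑ y ∈ K', P K' y := Finset.sum_le_sum_of_subset_of_nonneg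
            (Finset.subset_union_left.trans (Finset.subset_insert _ _)) fun y _ _ => hP0 _ _
      _ ≤ 1 := hmass K' t ht x (Finset.mem_insert_self _ _)
  have hbdd : ∀ y, BddAbove (Set.range fun K => P K y) := fun y =>
    ⟨1, by rintro _ ⟨K, rfl⟩; simpa using hsum {y} K⟩
  have hlim : ∀ y, Tendsto (fun K => P K y) atTop (𝓝 (G.heatKernel t x y * G.m y)) := by
    intro y
    have h1 := tendsto_atTop_ciSup (hmono y) (hbdd y)
    have h2 : Tendsto (fun K => G.restrictedHeatKernel K t x y) atTop
        (𝓝 ((⨆ K, P K y) * (G.m y)⁻¹)) := by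
      refine (h1.mul_const (G.m y)⁻¹).congr fun K => ?_
      simp only [hP]
      rw [mul_assoc, mul_inv_cancel₀ (G.m_pos y).ne', mul_one]
    have h3 := tendsto_nhds_limUnder ⟨_, h2⟩
    exact h3.mul_const (G.m y)
  have hle : ∀ K y, P K y ≤ G.heatKernel t x y * G.m y := fun K y =>
    (hmono y).ge_of_tendsto (hlim y) K
  have hupper : ∀ F : Finset X, ∑ y ∈ F, G.heatKernel t x y * G.m y ≤ 1 := fun F =>
    le_of_tendsto' (tendsto_finsetSum F fun y _ => hlim y) fun K => hsum F K
  have hnonneg : ∀ y, 0 ≤ G.heatKernel t x y * G.m y := fun y => (hP0 ∅ y).trans (hle ∅ y)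
  refine hasSum_of_isLUB_of_nonneg _ hnonneg ⟨?_, fun c hc => ?_⟩
  · rintro _ ⟨F, rfl⟩
    exact hupper F
  · refine le_of_forall_pos_lt_add fun ε hε => ?_
    obtain ⟨K, hxK, hK⟩ := G.exists_small_resolvent_solution hG U hU0 hU1 hU x
      (div_pos hε (Real.exp_pos t))
    have h1 := hcomp K t ht x hxK
    have h2 : Real.exp t * U K x < ε := by
      rw [lt_div_iff₀ (Real.exp_pos t)] at hK
      linarith
    have h3 : ∑ y ∈ K, P K y ≤ c :=
      (Finset.sum_le_sum fun y _ => hle K y).trans (hc ⟨K, rfl⟩)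
    simp only [hP] at h3
    linarith

/-! ### Truncated powers and the time-dependent Gaussian weight -/

theorem hasDerivAt_max_zero_pow (n : ℕ) (x : ℝ) :
    HasDerivAt (fun x : ℝ => (max x 0) ^ (n + 2)) ((n + 2) * (max x 0) ^ (n + 1)) x := by
  have hne : ∀ y : ℝ, y ≠ 0 →
      HasDerivAt (fun x : ℝ => (max x 0) ^ (n + 2)) ((n + 2) * (max y 0) ^ (n + 1)) y := by
    intro y hy
    rcases lt_or_gt_of_ne hy with h | h
    · rw [max_eq_right h.le, zero_pow (Nat.succ_ne_zero n), mul_zero]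
      refine (hasDerivAt_const y (0 : ℝ)).congr_of_eventuallyEq ?_
      filter_upwards [eventually_lt_nhds h] with z hz
      rw [max_eq_right hz.le, zero_pow (by omega)]
    · rw [max_eq_left h.le]
      have := hasDerivAt_pow (n + 2) y
      simp only [Nat.add_succ_sub_one, Nat.cast_add, Nat.cast_ofNat] at this
      refine this.congr_of_eventuallyEq ?_
      filter_upwards [eventually_gt_nhds h] with z hz
      rw [max_eq_left hz.le]
  by_cases hx : x = 0
  · subst hx
    exact hasDerivAt_of_hasDerivAt_of_ne hne (by fun_prop) (by fun_prop)
  · exact hne x hx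

/-- Integration of a pointwise differential inequality over a rectangle. -/
theorem integral_sub_integral_le_of_deriv_le {F F' J J' : ℝ → ℝ → ℝ} {a b e : ℝ} (hab : a ≤ b)
    (hF : Continuous (Function.uncurry F)) (hF' : Continuous (Function.uncurry F'))
    (hJ' : Continuous (Function.uncurry J'))
    (hFd : ∀ s t, HasDerivAt (fun t => F s t) (F' s t) t)
    (hJd : ∀ s t, HasDerivAt (fun s => J s t) (J' s t) s)
    (hle : ∀ s ∈ Set.Icc (0 : ℝ) 1, ∀ t ∈ Set.Icc a b, F' s t ≤ J' s t + e) :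
    (∫ s in (0 : ℝ)..1, F s b) - (∫ s in (0 : ℝ)..1, F s a) ≤
      (∫ t in a..b, (J 1 t - J 0 t)) + e * (b - a) := by
  have hcs : ∀ {f : ℝ → ℝ → ℝ}, Continuous (Function.uncurry f) → ∀ s, Continuous (f s) :=
    fun hf s => hf.comp (by fun_prop : Continuous fun t : ℝ => (s, t))
  have hct : ∀ {f : ℝ → ℝ → ℝ}, Continuous (Function.uncurry f) → ∀ t, Continuous (fun s => f s t) :=
    fun hf t => hf.comp (by fun_prop : Continuous fun s : ℝ => (s, t))
  have e1 : (∫ s in (0 : ℝ)..1, F s b) - (∫ s in (0 : ℝ)..1, F s a) =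
      ∫ s in (0 : ℝ)..1, ∫ t in a..b, F' s t := by
    rw [← intervalIntegral.integral_sub ((hct hF b).intervalIntegrable _ _)
      ((hct hF a).intervalIntegrable _ _)]
    refine intervalIntegral.integral_congr fun s _ => ?_
    exact (intervalIntegral.integral_eq_sub_of_hasDerivAt (fun t _ => hFd s t)
      ((hcs hF' s).intervalIntegrable _ _)).symm
  have e2 : ∫ s in (0 : ℝ)..1, ∫ t in a..b, J' s t = ∫ t in a..b, (J 1 t - J 0 t) := by
    rw [intervalIntegral_intervalIntegral_swap ((hJ'.continuousOn.integrableOn_compact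
      (isCompact_uIcc.prod isCompact_uIcc)).mono_set
      (Set.prod_mono Set.uIoc_subset_uIcc Set.uIoc_subset_uIcc))]
    refine intervalIntegral.integral_congr fun t _ => ?_
    exact intervalIntegral.integral_eq_sub_of_hasDerivAt (fun s _ => hJd s t)
      ((hct hJ' t).intervalIntegrable _ _)
  have c1 : Continuous fun s => ∫ t in a..b, F' s t :=
    intervalIntegral.continuous_parametric_intervalIntegral_of_continuous' hF' a b
  have c2 : Continuous fun s => ∫ t in a..b, J' s t :=
    intervalIntegral.continuous_parametric_intervalIntegral_of_continuous' hJ' a b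
  rw [e1, ← e2]
  have e3 : (∫ s in (0 : ℝ)..1, ((∫ t in a..b, J' s t) + e * (b - a))) =
      (∫ s in (0 : ℝ)..1, ∫ t in a..b, J' s t) + e * (b - a) := by
    rw [intervalIntegral.integral_add (c2.intervalIntegrable _ _) (by simp)]
    simp
  rw [← e3]
  refine intervalIntegral.integral_mono_on zero_le_one (c1.intervalIntegrable _ _)
    ((c2.add continuous_const).intervalIntegrable _ _) fun s hs => ?_
  have e4 : (∫ t in a..b, (J' s t + e)) = (∫ t in a..b, J' s t) + e * (b - a) := by
    rw [intervalIntegral.integral_add ((hcs hJ' s).intervalIntegrable _ _) (by simp)]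
    simp [mul_comm]
  rw [← e4]
  exact intervalIntegral.integral_mono_on hab ((hcs hF' s).intervalIntegrable _ _)
    (((hcs hJ' s).add continuous_const).intervalIntegrable _ _) fun t ht => hle s hs t ht

/-- The Gaussian weight, with decay rate `θ` growing linearly in time, lowered by a constant so
that its positive part has bounded support. -/
noncomputable def gaussianCutoff (R δ a r t : ℝ) : ℝ :=
  Real.exp (-(max (r - R) 0) ^ 2 * ((1 + (t - a) / δ) / (16 * δ))) - Real.exp (-(R ^ 2 / (4 * δ)))

/-- The square of the positive part of the Gaussian cutoff. -/
noncomputable def gaussianWeight (R δ a r t : ℝ) : ℝ :=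
  (max (gaussianCutoff R δ a r t) 0) ^ 2

theorem continuous_gaussianWeight (R δ a : ℝ) {Y : Type*} [TopologicalSpace Y] {f g : Y → ℝ}
    (hf : Continuous f) (hg : Continuous g) :
    Continuous fun y => gaussianWeight R δ a (f y) (g y) := by
  unfold gaussianWeight gaussianCutoff
  fun_prop

theorem gaussianWeight_nonneg (R δ a r t : ℝ) : 0 ≤ gaussianWeight R δ a r t := by
  unfold gaussianWeight; positivity

theorem gaussianCutoff_le_one {R δ a r t : ℝ} (hδ : 0 < δ) (ht : a ≤ t) :
    gaussianCutoff R δ a r t ≤ 1 := by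
  have h1 : Real.exp (-(max (r - R) 0) ^ 2 * ((1 + (t - a) / δ) / (16 * δ))) ≤ 1 := by
    rw [Real.exp_le_one_iff, neg_mul, neg_nonpos]
    have : 0 ≤ (t - a) / δ := div_nonneg (by linarith) hδ.le
    positivity
  have := Real.exp_pos (-(R ^ 2 / (4 * δ)))
  unfold gaussianCutoff
  linarith

theorem gaussianWeight_le_one {R δ a r t : ℝ} (hδ : 0 < δ) (ht : a ≤ t) :
    gaussianWeight R δ a r t ≤ 1 :=
  pow_le_one₀ (le_max_right _ _) (max_le (gaussianCutoff_le_one hδ ht) zero_le_one)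

/-- The subtracted constant is the value of the Gaussian at `r = 3R` and `t = a`; the Gaussian
decreases in `r` and in `t`. -/
theorem gaussianCutoff_nonpos {R δ a r t : ℝ} (hR : 0 < R) (hδ : 0 < δ) (ht : a ≤ t)
    (hr : 3 * R ≤ r) : gaussianCutoff R δ a r t ≤ 0 := by
  unfold gaussianCutoff
  rw [sub_nonpos, Real.exp_le_exp, max_eq_left (by linarith), neg_mul, neg_le_neg_iff]
  have h0 : 0 ≤ (t - a) / δ := div_nonneg (by linarith) hδ.le
  calc R ^ 2 / (4 * δ) = (2 * R) ^ 2 * (1 / (16 * δ)) := by field_simp; norm_num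
    _ ≤ (r - R) ^ 2 * ((1 + (t - a) / δ) / (16 * δ)) := by
      gcongr
      · linarith
      · linarith

theorem gaussianWeight_eq_zero {R δ a r t : ℝ} (hR : 0 < R) (hδ : 0 < δ) (ht : a ≤ t)
    (hr : 3 * R ≤ r) : gaussianWeight R δ a r t = 0 := by
  rw [gaussianWeight, max_eq_right (gaussianCutoff_nonpos hR hδ ht hr)]
  norm_num

/-- Up to radius `R` the Gaussian is one and the subtracted constant is at most `1/4`, so the square
is at least `9/16`. -/
theorem half_le_gaussianWeight {R δ a r t : ℝ} (hR : 3 ≤ R) (hδ : 0 < δ) (hδ1 : δ ≤ 1)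
    (hr : r ≤ R) : 1 / 2 ≤ gaussianWeight R δ a r t := by
  have hκ : Real.exp (-(R ^ 2 / (4 * δ))) ≤ 1 / 4 := by
    have h1 : (2 : ℝ) ≤ R ^ 2 / (4 * δ) := by
      rw [le_div_iff₀ (by positivity)]
      nlinarith
    have h2 : Real.exp (-(R ^ 2 / (4 * δ))) ≤ Real.exp (-2) := Real.exp_le_exp.2 (by linarith)
    have h3 : Real.exp (-2) ≤ 1 / 4 := by
      have h4 : (2 : ℝ) ≤ Real.exp 1 := by linarith [Real.add_one_le_exp 1]
      have h5 : Real.exp 2 = Real.exp 1 * Real.exp 1 := by rw [← Real.exp_add]; norm_num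
      rw [Real.exp_neg, h5, one_div]
      exact inv_anti₀ (by norm_num) (by nlinarith)
    linarith
  have hk : 3 / 4 ≤ gaussianCutoff R δ a r t := by
    unfold gaussianCutoff
    rw [max_eq_right (by linarith)]
    simp only [ne_eq, OfNat.ofNat_ne_zero, not_false_eq_true, zero_pow, neg_zero, zero_mul,
      Real.exp_zero]
    linarith
  unfold gaussianWeight
  have := le_max_left (gaussianCutoff R δ a r t) 0
  nlinarith

/-- The time derivative of the Gaussian weight. -/
noncomputable def gaussianWeightTime (R δ a r t : ℝ) : ℝ :=
  2 * max (gaussianCutoff R δ a r t) 0 *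
    (-(max (r - R) 0) ^ 2 * (1 / (16 * δ ^ 2)) *
      Real.exp (-(max (r - R) 0) ^ 2 * ((1 + (t - a) / δ) / (16 * δ))))

/-- The radial derivative of the Gaussian weight. -/
noncomputable def gaussianWeightRadial (R δ a r t : ℝ) : ℝ :=
  2 * max (gaussianCutoff R δ a r t) 0 *
    (-(2 * max (r - R) 0) * ((1 + (t - a) / δ) / (16 * δ)) *
      Real.exp (-(max (r - R) 0) ^ 2 * ((1 + (t - a) / δ) / (16 * δ))))

theorem hasDerivAt_gaussianWeight_time {R δ a : ℝ} (hδ : 0 < δ) (r t : ℝ) :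
    HasDerivAt (fun t => gaussianWeight R δ a r t) (gaussianWeightTime R δ a r t) t := by
  have h1 : HasDerivAt (fun t => -(max (r - R) 0) ^ 2 * ((1 + (t - a) / δ) / (16 * δ)))
      (-(max (r - R) 0) ^ 2 * (1 / (16 * δ ^ 2))) t := by
    have := (((((hasDerivAt_id t).sub_const a).div_const δ).const_add 1).div_const
      (16 * δ)).const_mul (-(max (r - R) 0) ^ 2)
    refine this.congr_deriv ?_
    field_simp
  have h2 := (h1.exp).sub_const (Real.exp (-(R ^ 2 / (4 * δ))))
  have h3 := (hasDerivAt_max_zero_pow 0 (gaussianCutoff R δ a r t)).comp t h2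
  refine h3.congr_deriv ?_
  simp only [gaussianWeightTime]
  push_cast
  ring

theorem hasDerivAt_gaussianWeight_radial (R δ a r t : ℝ) :
    HasDerivAt (fun r => gaussianWeight R δ a r t) (gaussianWeightRadial R δ a r t) r := by
  have h0 := (hasDerivAt_max_zero_pow 0 (r - R)).comp r ((hasDerivAt_id r).sub_const R)
  have h1 : HasDerivAt (fun r => -(max (r - R) 0) ^ 2 * ((1 + (t - a) / δ) / (16 * δ)))
      (-(2 * max (r - R) 0) * ((1 + (t - a) / δ) / (16 * δ))) r := by
    refine (h0.neg.mul_const _).congr_deriv ?_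
    push_cast
    ring
  have h2 := (h1.exp).sub_const (Real.exp (-(R ^ 2 / (4 * δ))))
  have h3 := (hasDerivAt_max_zero_pow 0 (gaussianCutoff R δ a r t)).comp r h2
  refine h3.congr_deriv ?_
  simp only [gaussianWeightRadial]
  push_cast
  ring

theorem gaussianWeightTime_nonpos {R δ a : ℝ} (r t : ℝ) :
    gaussianWeightTime R δ a r t ≤ 0 := by
  unfold gaussianWeightTime
  refine mul_nonpos_of_nonneg_of_nonpos (by positivity) ?_
  rw [neg_mul, neg_mul, neg_nonpos]
  positivity

/-- Completing the square: the Gaussian weight is a supersolution up to the error created by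
lowering it. -/
theorem gaussianWeight_inequality {R δ a t r : ℝ} (hδ : 0 < δ) (ht : a ≤ t) (htb : t ≤ a + δ)
    {P q' l r' : ℝ} (hP0 : 0 ≤ P) (hP1 : P ≤ 1) (hr' : r' ^ 2 ≤ l ^ 2) :
    l ^ 2 * (4 * P ^ 3 * gaussianWeight R δ a r t + P ^ 4 * gaussianWeightTime R δ a r t) ≤
      12 * P ^ 2 * q' ^ 2 * gaussianWeight R δ a r t
        + 4 * P ^ 3 * (2 * l ^ 2) * gaussianWeight R δ a r t
        + 4 * P ^ 3 * q' * (gaussianWeightRadial R δ a r t * r')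
        + 2 * l ^ 2 * (Real.exp (-(R ^ 2 / (4 * δ))) / δ) := by
  unfold gaussianWeightTime gaussianWeightRadial gaussianWeight
  set κ := Real.exp (-(R ^ 2 / (4 * δ))) with hκ
  have hκ0 : 0 < κ := Real.exp_pos _
  set θ := (1 + (t - a) / δ) / (16 * δ) with hθ
  set d := max (r - R) 0 with hd
  have hd0 : 0 ≤ d := le_max_right _ _
  set h := Real.exp (-d ^ 2 * θ) with hh
  have hh0 : 0 < h := Real.exp_pos _
  have hk : gaussianCutoff R δ a r t = h - κ := rfl
  rw [hk]
  have hθ1 : 1 / (16 * δ) ≤ θ := by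
    rw [hθ]
    have h0 : 0 ≤ (t - a) / δ := div_nonneg (by linarith) hδ.le
    gcongr
    linarith
  have hθ2 : θ ≤ 1 / (8 * δ) := by
    have h0 : (t - a) / δ ≤ 1 := by rw [div_le_one hδ]; linarith
    calc θ ≤ (1 + 1) / (16 * δ) := by rw [hθ]; gcongr
      _ = 1 / (8 * δ) := by field_simp; norm_num
  have hθ0 : 0 < θ := lt_of_lt_of_le (by positivity) hθ1
  set η := 1 / (16 * δ ^ 2) with hη
  have hη0 : 0 < η := by positivity
  -- With `η` the time derivative of `θ`, this makes the Gaussian a supersolution; equality holds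
  -- for `θ = 1/(8δ)`, its value at `t = a + δ`.
  have hη1 : 4 * θ ^ 2 ≤ η := by
    calc 4 * θ ^ 2 ≤ 4 * (1 / (8 * δ)) ^ 2 := by gcongr
      _ = η := by rw [hη]; field_simp; norm_num
  have hη2 : η ≤ θ / δ := by
    calc η = 1 / (16 * δ) / δ := by rw [hη]; field_simp
      _ ≤ θ / δ := by gcongr
  have hdh : d ^ 2 * θ * h ≤ 1 := by
    have h1 : d ^ 2 * θ ≤ Real.exp (d ^ 2 * θ) := by linarith [Real.add_one_le_exp (d ^ 2 * θ)]
    calc d ^ 2 * θ * h ≤ Real.exp (d ^ 2 * θ) * h := by gcongr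
      _ = 1 := by rw [hh, ← Real.exp_add]; simp
  have hη3 : d ^ 2 * η * h ≤ 1 / δ := by
    calc d ^ 2 * η * h ≤ d ^ 2 * (θ / δ) * h := by gcongr
      _ = d ^ 2 * θ * h / δ := by ring
      _ ≤ 1 / δ := by gcongr
  have herr : 0 ≤ 2 * l ^ 2 * (κ / δ) := by positivity
  rcases le_or_gt (h - κ) 0 with hneg | hpos
  · rw [max_eq_right hneg]
    simpa using herr
  · rw [max_eq_left hpos.le]
    set k := h - κ with hkdef
    have hsq : 0 ≤ 12 * (P * q' * k - 2 / 3 * (P ^ 2 * θ * d * r' * h)) ^ 2 := by positivity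
    have hP4 : P ^ 4 ≤ 1 := pow_le_one₀ hP0 hP1
    have hA : 16 / 3 * (P ^ 2 * θ * d * r' * h) ^ 2 ≤ 4 / 3 * (P ^ 4 * η * d ^ 2 * l ^ 2 * h ^ 2) := by
      calc 16 / 3 * (P ^ 2 * θ * d * r' * h) ^ 2
          = 4 / 3 * (P ^ 4 * (4 * θ ^ 2) * d ^ 2 * r' ^ 2 * h ^ 2) := by ring
        _ ≤ 4 / 3 * (P ^ 4 * η * d ^ 2 * l ^ 2 * h ^ 2) := by gcongr
    have hB : 2 * l ^ 2 * P ^ 4 * κ * (d ^ 2 * η * h) ≤ 2 * l ^ 2 * (κ / δ) := by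
      calc 2 * l ^ 2 * P ^ 4 * κ * (d ^ 2 * η * h) ≤ 2 * l ^ 2 * 1 * κ * (1 / δ) := by gcongr
        _ = _ := by ring
    have hC : 0 ≤ 2 / 3 * (P ^ 4 * η * d ^ 2 * l ^ 2 * h ^ 2) := by positivity
    have hD : 0 ≤ 4 * P ^ 3 * l ^ 2 * k ^ 2 := by positivity
    have hkk : h = k + κ := by rw [hkdef]; ring
    -- Writing `k h = h² - κ h` in the time derivative, the `h²` part has coefficient 2: of it,
    -- `4/3` absorbs the remainder of the completed square and `2/3` is surplus. The `κ h` part is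
    -- the cutoff error.
    have hid : 12 * P ^ 2 * q' ^ 2 * k ^ 2 + 4 * P ^ 3 * (2 * l ^ 2) * k ^ 2
        + 4 * P ^ 3 * q' * (2 * k * (-(2 * d) * θ * h) * r') + 2 * l ^ 2 * (κ / δ)
        - l ^ 2 * (4 * P ^ 3 * k ^ 2 + P ^ 4 * (2 * k * (-d ^ 2 * η * h)))
        = 12 * (P * q' * k - 2 / 3 * (P ^ 2 * θ * d * r' * h)) ^ 2
          + (4 / 3 * (P ^ 4 * η * d ^ 2 * l ^ 2 * h ^ 2) - 16 / 3 * (P ^ 2 * θ * d * r' * h) ^ 2)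
          + (2 * l ^ 2 * (κ / δ) - 2 * l ^ 2 * P ^ 4 * κ * (d ^ 2 * η * h))
          + 2 / 3 * (P ^ 4 * η * d ^ 2 * l ^ 2 * h ^ 2) + 4 * P ^ 3 * l ^ 2 * k ^ 2 := by
      rw [hkdef]
      ring
    linarith

/-! ### The energy on a single edge -/

/-- The function with second derivative `2 * l ^ 2` on an edge of length `l`, parametrized by
`[0, 1]`, with values `u₀` and `u₁` at the ends. -/
noncomputable def edgeProfile (u₀ u₁ l s : ℝ) : ℝ :=
  (1 - s) * u₀ + s * u₁ - l ^ 2 * (s * (1 - s))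

theorem hasDerivAt_edgeProfile (u₀ u₁ l s : ℝ) :
    HasDerivAt (edgeProfile u₀ u₁ l) (u₁ - u₀ - l ^ 2 * (1 - 2 * s)) s := by
  have h := ((((hasDerivAt_id s).const_sub 1).mul_const u₀).add
    ((hasDerivAt_id s).mul_const u₁)).sub
    (((hasDerivAt_id s).mul ((hasDerivAt_id s).const_sub 1)).const_mul (l ^ 2))
  refine h.congr_deriv ?_
  simp only [id]
  ring

theorem edgeProfile_nonpos {u₀ u₁ l s : ℝ} (h₀ : u₀ ≤ 0) (h₁ : u₁ ≤ 0)
    (hs : s ∈ Set.Icc (0 : ℝ) 1) : edgeProfile u₀ u₁ l s ≤ 0 := by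
  have h2 : 0 ≤ 1 - s := by linarith [hs.2]
  have h3 := mul_nonneg (sq_nonneg l) (mul_nonneg hs.1 h2)
  unfold edgeProfile
  nlinarith [mul_nonneg h2 (neg_nonneg.2 h₀), mul_nonneg hs.1 (neg_nonneg.2 h₁)]

/-- The integral over an edge of the fourth power of the positive part of the edge profile at
time `t`, with a radial weight `w`. -/
noncomputable def edgeIntegral (w : ℝ → ℝ) (u₀ u₁ l r₀ r₁ t : ℝ) : ℝ :=
  ∫ s in (0 : ℝ)..1, (max (edgeProfile u₀ u₁ l s + t) 0) ^ 4 * w ((1 - s) * r₀ + s * r₁)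

/-- Integrating `gaussianWeight_inequality` over the edge and the time interval leaves the flux `4
P³ q' w` at the two ends. The terms `± l²` come from the slope of the bent profile there, and the
last term is the cutoff error. -/
theorem edgeIntegral_sub_le {R δ a u₀ u₁ l r₀ r₁ : ℝ} (hδ : 0 < δ) (ha : a + δ ≤ 1)
    (h₀ : u₀ ≤ 0) (h₁ : u₁ ≤ 0) (hr : |r₁ - r₀| ≤ l) :
    l ^ 2 * edgeIntegral (fun r => gaussianWeight R δ a r (a + δ)) u₀ u₁ l r₀ r₁ (a + δ) -
      l ^ 2 * edgeIntegral (fun r => gaussianWeight R δ a r a) u₀ u₁ l r₀ r₁ a ≤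
    (∫ t in a..(a + δ),
      (4 * (max (u₁ + t) 0) ^ 3 * gaussianWeight R δ a r₁ t * (u₁ - u₀ + l ^ 2)
        - 4 * (max (u₀ + t) 0) ^ 3 * gaussianWeight R δ a r₀ t * (u₁ - u₀ - l ^ 2)))
      + 2 * l ^ 2 * Real.exp (-(R ^ 2 / (4 * δ))) := by
  have hq : Continuous (edgeProfile u₀ u₁ l) := by unfold edgeProfile; fun_prop
  have hr2 : (r₁ - r₀) ^ 2 ≤ l ^ 2 := sq_le_sq' (by linarith [neg_abs_le (r₁ - r₀)])
    (by linarith [le_abs_self (r₁ - r₀)])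
  have hrd : ∀ s, HasDerivAt (fun s : ℝ => (1 - s) * r₀ + s * r₁) (r₁ - r₀) s := by
    intro s
    refine ((((hasDerivAt_id s).const_sub 1).mul_const r₀).add
      ((hasDerivAt_id s).mul_const r₁)).congr_deriv ?_
    ring
  have key := integral_sub_integral_le_of_deriv_le (a := a) (b := a + δ)
    (e := 2 * l ^ 2 * (Real.exp (-(R ^ 2 / (4 * δ))) / δ))
    (F := fun s t => l ^ 2 * ((max (edgeProfile u₀ u₁ l s + t) 0) ^ 4 *
      gaussianWeight R δ a ((1 - s) * r₀ + s * r₁) t))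
    (F' := fun s t => l ^ 2 * (4 * (max (edgeProfile u₀ u₁ l s + t) 0) ^ 3 *
      gaussianWeight R δ a ((1 - s) * r₀ + s * r₁) t + (max (edgeProfile u₀ u₁ l s + t) 0) ^ 4 *
      gaussianWeightTime R δ a ((1 - s) * r₀ + s * r₁) t))
    (J := fun s t => 4 * (max (edgeProfile u₀ u₁ l s + t) 0) ^ 3 *
      (u₁ - u₀ - l ^ 2 * (1 - 2 * s)) * gaussianWeight R δ a ((1 - s) * r₀ + s * r₁) t)
    (J' := fun s t => 12 * (max (edgeProfile u₀ u₁ l s + t) 0) ^ 2 *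
        (u₁ - u₀ - l ^ 2 * (1 - 2 * s)) ^ 2 * gaussianWeight R δ a ((1 - s) * r₀ + s * r₁) t
      + 4 * (max (edgeProfile u₀ u₁ l s + t) 0) ^ 3 * (2 * l ^ 2) *
        gaussianWeight R δ a ((1 - s) * r₀ + s * r₁) t
      + 4 * (max (edgeProfile u₀ u₁ l s + t) 0) ^ 3 * (u₁ - u₀ - l ^ 2 * (1 - 2 * s)) *
        (gaussianWeightRadial R δ a ((1 - s) * r₀ + s * r₁) t * (r₁ - r₀)))
    (by linarith)
    (by unfold gaussianWeight gaussianCutoff Function.uncurry; fun_prop)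
    (by unfold gaussianWeightTime gaussianWeight gaussianCutoff Function.uncurry; fun_prop)
    (by unfold gaussianWeightRadial gaussianWeight gaussianCutoff Function.uncurry; fun_prop)
    (fun s t => ?_) (fun s t => ?_) (fun s hs t ht => ?_)
  · simp only [intervalIntegral.integral_const_mul] at key
    unfold edgeIntegral
    refine key.trans (le_of_eq ?_)
    congr 1
    · refine intervalIntegral.integral_congr fun t _ => ?_
      simp only [edgeProfile]
      ring_nf
    · rw [add_sub_cancel_left]
      field_simp
  · have h1 := (hasDerivAt_max_zero_pow 2 (edgeProfile u₀ u₁ l s + t)).comp t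
      ((hasDerivAt_id t).const_add (edgeProfile u₀ u₁ l s))
    have h2 := hasDerivAt_gaussianWeight_time (R := R) (a := a) hδ ((1 - s) * r₀ + s * r₁) t
    refine ((h1.mul h2).const_mul (l ^ 2)).congr_deriv ?_
    simp only [Function.comp]
    push_cast
    ring
  · have h1 := (hasDerivAt_max_zero_pow 1 (edgeProfile u₀ u₁ l s + t)).comp s
      ((hasDerivAt_edgeProfile u₀ u₁ l s).add_const t)
    have h2 := (hasDerivAt_gaussianWeight_radial R δ a ((1 - s) * r₀ + s * r₁) t).comp s (hrd s)
    have h3 : HasDerivAt (fun s : ℝ => u₁ - u₀ - l ^ 2 * (1 - 2 * s)) (2 * l ^ 2) s := by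
      refine (((((hasDerivAt_id s).const_mul 2).const_sub 1).const_mul (l ^ 2)).const_sub
        (u₁ - u₀)).congr_deriv ?_
      ring
    refine (((h1.const_mul 4).mul h3).mul h2).congr_deriv ?_
    simp only [Function.comp, Pi.mul_apply]
    push_cast
    ring
  · refine gaussianWeight_inequality hδ ht.1 ht.2 (le_max_right _ _) (max_le ?_ zero_le_one) hr2
    -- The profile is nonpositive and `t ≤ 1`, so the truncated function is at most one; only this
    -- allows a cutoff error free of `U`.
    linarith [ht.2, edgeProfile_nonpos (l := l) h₀ h₁ hs]

theorem edgeIntegral_eq_zero {w : ℝ → ℝ} {u₀ u₁ l r₀ r₁ t ρ : ℝ} (hr₀ : ρ ≤ r₀) (hr₁ : ρ ≤ r₁)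
    (hw : ∀ r, ρ ≤ r → w r = 0) : edgeIntegral w u₀ u₁ l r₀ r₁ t = 0 := by
  unfold edgeIntegral
  refine intervalIntegral.integral_zero_ae (ae_of_all _ fun s hs => ?_)
  rw [Set.uIoc_of_le zero_le_one] at hs
  rw [hw, mul_zero]
  nlinarith [hs.1, hs.2]

theorem edgeIntegral_eq_zero_of_nonpos {w : ℝ → ℝ} {u₀ u₁ l r₀ r₁ : ℝ} (h₀ : u₀ ≤ 0) (h₁ : u₁ ≤ 0) :
    edgeIntegral w u₀ u₁ l r₀ r₁ 0 = 0 := by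
  unfold edgeIntegral
  refine intervalIntegral.integral_zero_ae (ae_of_all _ fun s hs => ?_)
  rw [Set.uIoc_of_le zero_le_one] at hs
  rw [add_zero, max_eq_right (edgeProfile_nonpos h₀ h₁ ⟨hs.1.le, hs.2⟩)]
  norm_num

theorem edgeIntegral_nonneg {w : ℝ → ℝ} (hw : ∀ r, 0 ≤ w r) (u₀ u₁ l r₀ r₁ t : ℝ) :
    0 ≤ edgeIntegral w u₀ u₁ l r₀ r₁ t :=
  intervalIntegral.integral_nonneg zero_le_one fun s _ => mul_nonneg (by positivity) (hw _)

theorem edgeIntegral_le_mul {w w' : ℝ → ℝ} {c : ℝ} (hwc : Continuous w) (hwc' : Continuous w')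
    (hw : ∀ r, w r ≤ c * w' r) (u₀ u₁ l r₀ r₁ t : ℝ) :
    edgeIntegral w u₀ u₁ l r₀ r₁ t ≤ c * edgeIntegral w' u₀ u₁ l r₀ r₁ t := by
  have hq : Continuous (edgeProfile u₀ u₁ l) := by unfold edgeProfile; fun_prop
  unfold edgeIntegral
  rw [← intervalIntegral.integral_const_mul]
  refine intervalIntegral.integral_mono_on zero_le_one
    (Continuous.intervalIntegrable (by fun_prop) _ _)
    (Continuous.intervalIntegrable (by fun_prop) _ _) fun s _ => ?_
  have := mul_le_mul_of_nonneg_left (hw ((1 - s) * r₀ + s * r₁))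
    (by positivity : 0 ≤ (max (edgeProfile u₀ u₁ l s + t) 0) ^ 4)
  linarith

/-! ### The energy on the metric graph and its growth in one time step -/

open Classical in
/-- The edge weight with the edges of length greater than one removed. -/
noncomputable def shortWeight (G : WeightedGraph X) (ϱ : X → X → ℝ) (x y : X) : ℝ :=
  if ϱ x y ≤ 1 then G.b x y else 0

theorem shortWeight_nonneg (G : WeightedGraph X) (ϱ : X → X → ℝ) (x y : X) :
    0 ≤ G.shortWeight ϱ x y := by
  unfold shortWeight
  split_ifs
  exacts [G.b_nonneg x y, le_rfl]

theorem shortWeight_symm {G : WeightedGraph X} {ϱ : X → X → ℝ} (hϱ : G.IsIntrinsicMetric ϱ)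
    (x y : X) : G.shortWeight ϱ x y = G.shortWeight ϱ y x := by
  unfold shortWeight
  rw [hϱ.symm x y, G.b_symm x y]

theorem sum_shortWeight_mul_sq_le {G : WeightedGraph X} {ϱ : X → X → ℝ}
    (hϱ : G.IsIntrinsicMetric ϱ) (F : Finset X) (x : X) :
    ∑ y ∈ F, G.shortWeight ϱ x y * ϱ x y ^ 2 ≤ G.m x := by
  refine le_trans (Finset.sum_le_sum fun y _ => ?_)
    (((hϱ.summable x).sum_le_tsum F fun y _ => mul_nonneg (G.b_nonneg x y) (sq_nonneg _)).trans
      (hϱ.tsum_le x))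
  refine mul_le_mul_of_nonneg_right ?_ (sq_nonneg _)
  unfold shortWeight
  split_ifs
  exacts [le_rfl, G.b_nonneg x y]

/-- The energy at time `t` of the positive part of `U + t`, extended to the edges of the metric
graph that joins the vertices of `F`, with a radial weight `w`. -/
noncomputable def energy (G : WeightedGraph X) (ϱ : X → X → ℝ) (x₀ : X) (U : X → ℝ) (F : Finset X) (w : ℝ → ℝ)
    (t : ℝ) : ℝ :=
  ∑ x ∈ F, G.m x * ((max (U x + t) 0) ^ 4 * w (ϱ x x₀)) +
    1 / 2 * ∑ x ∈ F, ∑ y ∈ F, G.shortWeight ϱ x y * (ϱ x y ^ 2 *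
      edgeIntegral w (U x) (U y) (ϱ x y) (ϱ x x₀) (ϱ y x₀) t)

theorem energy_zero (G : WeightedGraph X) (ϱ : X → X → ℝ) (x₀ : X) {U : X → ℝ} (hU : ∀ x, U x ≤ 0)
    (F : Finset X) (w : ℝ → ℝ) : G.energy ϱ x₀ U F w 0 = 0 := by
  unfold energy
  simp [edgeIntegral_eq_zero_of_nonpos, hU]

theorem energy_le_mul (G : WeightedGraph X) (ϱ : X → X → ℝ) (x₀ : X) (U : X → ℝ)
    (F : Finset X) {w w' : ℝ → ℝ} {c : ℝ} (hwc : Continuous w) (hwc' : Continuous w')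
    (hw : ∀ r, w r ≤ c * w' r) (t : ℝ) :
    G.energy ϱ x₀ U F w t ≤ c * G.energy ϱ x₀ U F w' t := by
  unfold energy
  rw [mul_add, mul_left_comm c (1 / 2), Finset.mul_sum _ _ c, Finset.mul_sum _ _ c]
  refine add_le_add (Finset.sum_le_sum fun x _ => ?_)
    (mul_le_mul_of_nonneg_left (Finset.sum_le_sum fun x _ => ?_)
      (by norm_num : (0 : ℝ) ≤ 1 / 2))
  · have := mul_le_mul_of_nonneg_left (hw (ϱ x x₀))
      (mul_nonneg (G.m_pos x).le (by positivity : 0 ≤ (max (U x + t) 0) ^ 4))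
    linarith
  · rw [Finset.mul_sum]
    refine Finset.sum_le_sum fun y _ => ?_
    have := mul_le_mul_of_nonneg_left
      (edgeIntegral_le_mul hwc hwc' hw (U x) (U y) (ϱ x y) (ϱ x x₀) (ϱ y x₀) t)
      (mul_nonneg (G.shortWeight_nonneg ϱ x y) (sq_nonneg (ϱ x y)))
    linarith

theorem le_energy (G : WeightedGraph X) (ϱ : X → X → ℝ) (x₀ : X) (U : X → ℝ)
    {F : Finset X} {w : ℝ → ℝ} (hw : ∀ r, 0 ≤ w r) (t : ℝ) {x : X} (hx : x ∈ F) :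
    G.m x * ((max (U x + t) 0) ^ 4 * w (ϱ x x₀)) ≤ G.energy ϱ x₀ U F w t := by
  unfold energy
  have h1 := Finset.single_le_sum (f := fun x => G.m x * ((max (U x + t) 0) ^ 4 * w (ϱ x x₀)))
    (fun y _ => mul_nonneg (G.m_pos y).le (mul_nonneg (by positivity) (hw _))) hx
  have h2 : 0 ≤ ∑ x ∈ F, ∑ y ∈ F, G.shortWeight ϱ x y * (ϱ x y ^ 2 *
      edgeIntegral w (U x) (U y) (ϱ x y) (ϱ x x₀) (ϱ y x₀) t) :=
    Finset.sum_nonneg fun x _ => Finset.sum_nonneg fun y _ => mul_nonneg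
      (G.shortWeight_nonneg ϱ x y) (mul_nonneg (sq_nonneg _) (edgeIntegral_nonneg hw ..))
  linarith

/-- At a vertex only the decrease of the weight in time is used; its time derivative is dropped. -/
theorem vertex_sub_le {R δ a : ℝ} (hδ : 0 < δ) (u r : ℝ) :
    (max (u + (a + δ)) 0) ^ 4 * gaussianWeight R δ a r (a + δ) -
      (max (u + a) 0) ^ 4 * gaussianWeight R δ a r a ≤
    ∫ t in a..(a + δ), 4 * (max (u + t) 0) ^ 3 * gaussianWeight R δ a r t := by
  have hd : ∀ t, HasDerivAt (fun t => (max (u + t) 0) ^ 4 * gaussianWeight R δ a r t)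
      (4 * (max (u + t) 0) ^ 3 * gaussianWeight R δ a r t +
        (max (u + t) 0) ^ 4 * gaussianWeightTime R δ a r t) t := by
    intro t
    have h1 := (hasDerivAt_max_zero_pow 2 (u + t)).comp t ((hasDerivAt_id t).const_add u)
    refine (h1.mul (hasDerivAt_gaussianWeight_time (R := R) (a := a) hδ r t)).congr_deriv ?_
    simp only [Function.comp]
    push_cast
    ring
  have hc : Continuous fun t => 4 * (max (u + t) 0) ^ 3 * gaussianWeight R δ a r t +
        (max (u + t) 0) ^ 4 * gaussianWeightTime R δ a r t := by
    unfold gaussianWeightTime gaussianWeight gaussianCutoff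
    fun_prop
  rw [← intervalIntegral.integral_eq_sub_of_hasDerivAt (fun t _ => hd t)
    (hc.intervalIntegrable _ _)]
  refine intervalIntegral.integral_mono_on (by linarith) (hc.intervalIntegrable _ _)
    (Continuous.intervalIntegrable (by unfold gaussianWeight gaussianCutoff; fun_prop) _ _)
    fun t _ => ?_
  have := mul_nonpos_of_nonneg_of_nonpos (by positivity : 0 ≤ (max (u + t) 0) ^ 4)
    (gaussianWeightTime_nonpos (R := R) (δ := δ) (a := a) r t)
  linarith

/-- The divergence theorem on a finite graph, for a subsolution at the vertices where `A` does not
vanish. -/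
theorem sum_flux_nonpos {m A U : X → ℝ} {c d : X → X → ℝ} {F : Finset X}
    (hc : ∀ x y, c x y = c y x) (hd : ∀ x y, d x y = d y x) (hA : ∀ x, 0 ≤ A x)
    (hm : ∀ x, ∑ y ∈ F, c x y * d x y ≤ m x)
    (hU : ∀ x ∈ F, A x ≠ 0 → 2 * m x ≤ ∑ y ∈ F, c x y * (U y - U x)) :
    ∑ x ∈ F, m x * A x + 1 / 2 * ∑ x ∈ F, ∑ y ∈ F,
      c x y * (A y * (U y - U x + d x y) - A x * (U y - U x - d x y)) ≤ 0 := by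
  have h1 : ∑ x ∈ F, ∑ y ∈ F, c x y * (A y * (U y - U x + d x y)) =
      - ∑ x ∈ F, ∑ y ∈ F, c x y * (A x * (U y - U x - d x y)) := by
    rw [Finset.sum_comm, ← Finset.sum_neg_distrib]
    refine Finset.sum_congr rfl fun x _ => ?_
    rw [← Finset.sum_neg_distrib]
    refine Finset.sum_congr rfl fun y _ => ?_
    rw [hc y x, hd y x]
    ring
  have h2 : ∑ x ∈ F, ∑ y ∈ F, c x y * (A y * (U y - U x + d x y) - A x * (U y - U x - d x y)) =
      -2 * ∑ x ∈ F, ∑ y ∈ F, c x y * (A x * (U y - U x - d x y)) := by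
    simp only [mul_sub (c _ _) (A _ * _), Finset.sum_sub_distrib]
    rw [h1]
    ring
  -- The constant 2 in the subsolution bound is used up here: one `m x` for the left side, one for
  -- `∑ c d`.
  have h3 : ∀ x ∈ F, m x * A x ≤ ∑ y ∈ F, c x y * (A x * (U y - U x - d x y)) := by
    intro x hx
    have e : ∑ y ∈ F, c x y * (A x * (U y - U x - d x y)) =
        A x * (∑ y ∈ F, c x y * (U y - U x) - ∑ y ∈ F, c x y * d x y) := by
      rw [← Finset.sum_sub_distrib, Finset.mul_sum]
      exact Finset.sum_congr rfl fun y _ => by ring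
    rw [e]
    by_cases h : A x = 0
    · simp [h]
    · have := hU x hx h
      have := hm x
      rw [mul_comm]
      exact mul_le_mul_of_nonneg_left (by linarith) (hA x)
  rw [h2]
  have := Finset.sum_le_sum h3
  linarith

/-- Growth of the energy over a time interval of length `δ`. -/
theorem energy_add_le {G : WeightedGraph X} {ϱ : X → X → ℝ} (hϱ : G.IsIntrinsicMetric ϱ) (x₀ : X)
    {U : X → ℝ} (hU0 : ∀ x, U x ≤ 0)
    (hU : ∀ x, -1 < U x → ∀ F : Finset X, (∀ y, ϱ x y ≤ 1 → y ∈ F) →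
      2 * G.m x ≤ ∑ y ∈ F, G.shortWeight ϱ x y * (U y - U x))
    {R δ a V : ℝ} (hR : 0 < R) (hδ : 0 < δ) (ha : a + δ ≤ 1) {F : Finset X}
    (hF : ∀ x, ϱ x x₀ ≤ 3 * R + 1 → x ∈ F)
    (hV : ∑ x ∈ F with ϱ x x₀ ≤ 3 * R + 1, G.m x ≤ V) :
    G.energy ϱ x₀ U F (fun r => gaussianWeight R δ a r (a + δ)) (a + δ) ≤
      G.energy ϱ x₀ U F (fun r => gaussianWeight R δ a r a) a +
        Real.exp (-(R ^ 2 / (4 * δ))) * V := by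
  set κ := Real.exp (-(R ^ 2 / (4 * δ))) with hκ
  have hκ0 : 0 < κ := Real.exp_pos _
  have htri : ∀ x y, |ϱ y x₀ - ϱ x x₀| ≤ ϱ x y := by
    intro x y
    have h1 := hϱ.triangle y x x₀
    have h2 := hϱ.triangle x y x₀
    rw [hϱ.symm y x] at h1
    exact abs_le.2 ⟨by linarith, by linarith⟩
  set A : X → ℝ → ℝ := fun x t => 4 * (max (U x + t) 0) ^ 3 * gaussianWeight R δ a (ϱ x x₀) t
    with hA
  have hAc : ∀ x, Continuous (A x) := by
    intro x
    simp only [hA]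
    unfold gaussianWeight gaussianCutoff
    fun_prop
  set c := G.shortWeight ϱ with hc
  have hc0 : ∀ x y, 0 ≤ c x y := G.shortWeight_nonneg ϱ
  set I : X → X → ℝ → ℝ := fun x y t => c x y * (A y t * (U y - U x + ϱ x y ^ 2) -
    A x t * (U y - U x - ϱ x y ^ 2)) with hI
  have hIc : ∀ x y, Continuous (I x y) := by
    intro x y
    have := hAc x
    have := hAc y
    simp only [hI]
    fun_prop
  have hedge : ∀ x y, c x y * (ϱ x y ^ 2 * edgeIntegral (fun r => gaussianWeight R δ a r (a + δ))
        (U x) (U y) (ϱ x y) (ϱ x x₀) (ϱ y x₀) (a + δ)) -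
      c x y * (ϱ x y ^ 2 * edgeIntegral (fun r => gaussianWeight R δ a r a)
        (U x) (U y) (ϱ x y) (ϱ x x₀) (ϱ y x₀) a) ≤
      (∫ t in a..(a + δ), I x y t) +
        -- An edge with nonzero `c` has length at most one, so if `x` is farther than `3R + 1` the
        -- whole edge lies outside the support of the weight and creates no error.
        (if ϱ x x₀ ≤ 3 * R + 1 then 2 * κ * (c x y * ϱ x y ^ 2) else 0) := by
    intro x y
    by_cases hcx : c x y = 0
    · have : I x y = fun _ => 0 := by funext t; simp [hI, hcx]
      simp [hcx, this]
    by_cases hx : ϱ x x₀ ≤ 3 * R + 1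
    · rw [if_pos hx]
      have h1 := mul_le_mul_of_nonneg_left (edgeIntegral_sub_le (R := R) hδ ha (hU0 x) (hU0 y)
        (htri x y)) (hc0 x y)
      rw [mul_add, ← intervalIntegral.integral_const_mul] at h1
      simp only [hI, hA]
      linarith
    · rw [if_neg hx]
      have hxy : ϱ x y ≤ 1 := by
        by_contra h
        exact hcx (by simp [hc, shortWeight, h])
      have hx' : 3 * R ≤ ϱ x x₀ := by linarith
      have hy' : 3 * R ≤ ϱ y x₀ := by
        have := htri x y
        rw [abs_le] at this
        linarith [this.1]
      rw [edgeIntegral_eq_zero hx' hy' fun r hr => gaussianWeight_eq_zero hR hδ (by linarith) hr,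
        edgeIntegral_eq_zero hx' hy' fun r hr => gaussianWeight_eq_zero hR hδ le_rfl hr]
      have h2 : ∫ t in a..(a + δ), I x y t = ∫ t in a..(a + δ), 0 := by
        refine intervalIntegral.integral_congr fun t ht => ?_
        rw [Set.uIcc_of_le (by linarith)] at ht
        simp [hI, hA, gaussianWeight_eq_zero hR hδ ht.1 hx', gaussianWeight_eq_zero hR hδ ht.1 hy']
      simp [h2]
  have hvertex : ∀ x, G.m x * ((max (U x + (a + δ)) 0) ^ 4 *
        gaussianWeight R δ a (ϱ x x₀) (a + δ)) -
      G.m x * ((max (U x + a) 0) ^ 4 * gaussianWeight R δ a (ϱ x x₀) a) ≤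
      ∫ t in a..(a + δ), G.m x * A x t := by
    intro x
    rw [intervalIntegral.integral_const_mul, ← mul_sub]
    exact mul_le_mul_of_nonneg_left (vertex_sub_le hδ _ _) (G.m_pos x).le
  have hint : (∑ x ∈ F, ∫ t in a..(a + δ), G.m x * A x t) +
      1 / 2 * ∑ x ∈ F, ∑ y ∈ F, ∫ t in a..(a + δ), I x y t =
      ∫ t in a..(a + δ), (∑ x ∈ F, G.m x * A x t + 1 / 2 * ∑ x ∈ F, ∑ y ∈ F, I x y t) := by
    rw [intervalIntegral.integral_add, intervalIntegral.integral_const_mul,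
      intervalIntegral.integral_finsetSum, intervalIntegral.integral_finsetSum]
    · congr 2
      refine Finset.sum_congr rfl fun x _ => ?_
      rw [intervalIntegral.integral_finsetSum]
      exact fun y _ => (hIc x y).intervalIntegrable _ _
    · exact fun x _ => (continuous_finsetSum _ fun y _ => hIc x y).intervalIntegrable _ _
    · exact fun x _ => ((hAc x).const_mul _).intervalIntegrable _ _
    · exact (continuous_finsetSum _ fun x _ => (hAc x).const_mul _).intervalIntegrable _ _
    · exact ((continuous_finsetSum _ fun x _ => continuous_finsetSum _ fun y _ =>
        hIc x y).const_mul _).intervalIntegrable _ _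
  have hneg : ∫ t in a..(a + δ), (∑ x ∈ F, G.m x * A x t +
      1 / 2 * ∑ x ∈ F, ∑ y ∈ F, I x y t) ≤ 0 := by
    rw [← neg_nonneg, ← intervalIntegral.integral_neg]
    refine intervalIntegral.integral_nonneg (by linarith) fun t ht => ?_
    rw [neg_nonneg]
    -- Where `A x t` is nonzero, `U x > -t ≥ -1` and `x` is within `3R`, so `F` contains all points
    -- within distance one of `x`.
    refine sum_flux_nonpos (A := fun x => A x t) (d := fun x y => ϱ x y ^ 2)
      (shortWeight_symm hϱ) (fun x y => by rw [hϱ.symm])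
      (fun x => mul_nonneg (by positivity) (gaussianWeight_nonneg ..))
      (sum_shortWeight_mul_sq_le hϱ F) fun x _ hAx => hU x ?_ F fun y hy => hF y ?_
    · by_contra! h
      apply hAx
      simp only [hA]
      rw [max_eq_right (by linarith [ht.2])]
      norm_num
    · by_contra! h
      apply hAx
      have := htri x y
      rw [abs_le] at this
      simp only [hA]
      rw [gaussianWeight_eq_zero hR hδ ht.1 (by linarith [this.2]), mul_zero]
  have herr : 1 / 2 * ∑ x ∈ F, ∑ y ∈ F,
      (if ϱ x x₀ ≤ 3 * R + 1 then 2 * κ * (c x y * ϱ x y ^ 2) else 0) ≤ κ * V := by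
    have h1 : ∀ x ∈ F, ∑ y ∈ F,
        (if ϱ x x₀ ≤ 3 * R + 1 then 2 * κ * (c x y * ϱ x y ^ 2) else 0) ≤
        2 * κ * (if ϱ x x₀ ≤ 3 * R + 1 then G.m x else 0) := by
      intro x _
      split_ifs
      · rw [← Finset.mul_sum]
        exact mul_le_mul_of_nonneg_left (sum_shortWeight_mul_sq_le hϱ F x) (by positivity)
      · simp
    have h2 := Finset.sum_le_sum h1
    rw [← Finset.mul_sum, ← Finset.sum_filter] at h2
    have h3 := mul_le_mul_of_nonneg_left hV hκ0.le
    linarith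
  have hsum1 := Finset.sum_le_sum fun x (_ : x ∈ F) => hvertex x
  have hsum2 := Finset.sum_le_sum fun x (_ : x ∈ F) =>
    Finset.sum_le_sum fun y (_ : y ∈ F) => hedge x y
  simp only [Finset.sum_sub_distrib, Finset.sum_add_distrib] at hsum1 hsum2
  unfold energy
  rw [← hc]
  linarith

/-! ### Iteration over scales and the maximum principle -/

theorem logSharp_pos (v : ℝ) : 0 < logSharp v := lt_of_lt_of_le one_pos (le_max_right _ _)

/-- The error in the energy estimate at scale `R` is negligible for short time intervals. -/
theorem exp_neg_mul_le {R δ v : ℝ} (hR : 0 < R) (hδ : 0 < δ) (hδ1 : δ ≤ 1) (hv : 0 ≤ v)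
    (h : δ ≤ R ^ 2 / (8 * logSharp v)) : Real.exp (-(R ^ 2 / (4 * δ))) * v ≤ 8 / R ^ 2 := by
  have hl := logSharp_pos v
  -- Half of the exponent compensates the volume; the other half, using `δ ≤ 1`, gives the decay in
  -- `R`.
  have h1 : logSharp v + R ^ 2 / 8 ≤ R ^ 2 / (4 * δ) := by
    have h2 : logSharp v ≤ R ^ 2 / (8 * δ) := by
      rw [le_div_iff₀ (by positivity)] at h ⊢
      linarith
    have h3 : R ^ 2 / 8 ≤ R ^ 2 / (8 * δ) := by
      gcongr
      linarith
    have h4 : R ^ 2 / (4 * δ) = R ^ 2 / (8 * δ) + R ^ 2 / (8 * δ) := by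
      field_simp
      norm_num
    linarith
  have h5 : v ≤ Real.exp (logSharp v) := by
    rcases hv.eq_or_lt with h0 | h0
    · rw [← h0]; exact (Real.exp_pos _).le
    · calc v = Real.exp (Real.log v) := (Real.exp_log h0).symm
        _ ≤ _ := Real.exp_le_exp.2 (le_max_left _ _)
  have h6 : R ^ 2 / 8 ≤ Real.exp (R ^ 2 / 8) := by linarith [Real.add_one_le_exp (R ^ 2 / 8)]
  calc Real.exp (-(R ^ 2 / (4 * δ))) * v
      ≤ Real.exp (-(logSharp v + R ^ 2 / 8)) * Real.exp (logSharp v) := by gcongr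
    _ = (Real.exp (R ^ 2 / 8))⁻¹ := by rw [← Real.exp_add, ← Real.exp_neg]; ring_nf
    _ ≤ (R ^ 2 / 8)⁻¹ := inv_anti₀ (by positivity) h6
    _ = 8 / R ^ 2 := by rw [inv_div]

/-- Iteration of the energy estimate over the scales `3 ^ j`. -/
theorem energy_le_of_le_sum {G : WeightedGraph X} {ϱ : X → X → ℝ} (hϱ : G.IsIntrinsicMetric ϱ)
    (x₀ : X) {U : X → ℝ} (hU0 : ∀ x, U x ≤ 0)
    (hU : ∀ x, -1 < U x → ∀ F : Finset X, (∀ y, ϱ x y ≤ 1 → y ∈ F) →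
      2 * G.m x ≤ ∑ y ∈ F, G.shortWeight ϱ x y * (U y - U x))
    {v : ℕ → ℝ} (hv0 : ∀ i, 0 ≤ v i)
    (hv : ∀ i, ∀ F : Finset X, (∀ x ∈ F, ϱ x x₀ ≤ 3 ^ i) → ∑ x ∈ F, G.m x ≤ v i)
    (n : ℕ) : ∀ (j : ℕ) (t : ℝ), 1 ≤ j → 0 ≤ t → t ≤ 1 →
      t ≤ ∑ i ∈ Finset.range n, 9 ^ (j + i) / (8 * logSharp (v (j + i + 2))) →
      ∀ F : Finset X, (∀ x, ϱ x x₀ ≤ 3 ^ (j + n + 1) → x ∈ F) →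
      ∀ w : ℝ → ℝ, Continuous w → (∀ r, w r ≤ 1) → (∀ r, 3 ^ j ≤ r → w r = 0) →
      G.energy ϱ x₀ U F w t ≤ 32 / 4 ^ j := by
  induction n with
  | zero =>
    intro j t _ ht0 _ htn F _ w _ _ _
    have : t = 0 := le_antisymm (by simpa using htn) ht0
    rw [this, energy_zero G ϱ x₀ hU0]
    positivity
  | succ n ih =>
    intro j t hj ht0 ht1 htn F hF w hwc hw1 hw
    rcases ht0.eq_or_lt with h0 | h0
    · rw [← h0, energy_zero G ϱ x₀ hU0]
      positivity
    set d := (9 : ℝ) ^ j / (8 * logSharp (v (j + 2))) with hd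
    have hd0 : 0 < d := div_pos (by positivity) (mul_pos (by norm_num) (logSharp_pos _))
    -- Either a full admissible step `d` is taken, which removes the first term from the time
    -- budget, or time zero is reached, where the energy vanishes.
    set δ := min d t with hδ
    have hδ0 : 0 < δ := lt_min hd0 h0
    have hδ1 : δ ≤ 1 := (min_le_right _ _).trans ht1
    have hδt : δ ≤ t := min_le_right _ _
    set R : ℝ := 3 ^ j with hR
    have hR3 : 3 ≤ R := by
      calc (3 : ℝ) = 3 ^ 1 := by norm_num
        _ ≤ R := pow_le_pow_right₀ (by norm_num) hj
    have hR2 : R ^ 2 = 9 ^ j := by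
      rw [hR, ← pow_mul, mul_comm, pow_mul]
      norm_num
    set a := t - δ with ha
    have hat : a + δ = t := by rw [ha]; ring
    have hstep := energy_add_le hϱ x₀ hU0 hU (R := R) (δ := δ) (a := a) (V := v (j + 2)) (F := F)
      (by linarith) hδ0 (by linarith)
      (fun x hx => hF x (hx.trans (by
        have h1 : (1 : ℝ) ≤ 3 ^ n := one_le_pow₀ (by norm_num)
        have h2 : (3 : ℝ) ^ (j + (n + 1) + 1) = 9 * (R * 3 ^ n) := by rw [hR]; ring
        rw [h2]
        nlinarith)))
      (hv (j + 2) _ fun x hx => (Finset.mem_filter.1 hx).2.trans (by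
        have h2 : (3 : ℝ) ^ (j + 2) = 9 * R := by rw [hR]; ring
        rw [h2]
        linarith))
    rw [hat] at hstep
    have herr : Real.exp (-(R ^ 2 / (4 * δ))) * v (j + 2) ≤ 8 / R ^ 2 :=
      exp_neg_mul_le (by linarith) hδ0 hδ1 (hv0 _) ((min_le_left _ _).trans_eq (by rw [hd, hR2]))
    have hnext : G.energy ϱ x₀ U F (fun r => gaussianWeight R δ a r a) a ≤ 32 / 4 ^ (j + 1) := by
      refine ih (j + 1) a (by omega) (by linarith) (by linarith) ?_ F
        (fun x hx => hF x (hx.trans_eq (by ring))) _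
        (continuous_gaussianWeight R δ a continuous_id continuous_const)
        (fun r => gaussianWeight_le_one hδ0 le_rfl)
        (fun r hr => gaussianWeight_eq_zero (by linarith) hδ0 le_rfl (by
          rw [pow_succ] at hr; linarith))
      rw [Finset.sum_range_succ', add_zero, ← hd] at htn
      have e : ∑ i ∈ Finset.range n, (9 : ℝ) ^ (j + 1 + i) / (8 * logSharp (v (j + 1 + i + 2))) =
          ∑ i ∈ Finset.range n, (9 : ℝ) ^ (j + (i + 1)) / (8 * logSharp (v (j + (i + 1) + 2))) :=
        Finset.sum_congr rfl fun i _ => by rw [show j + 1 + i = j + (i + 1) by ring]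
      rw [e]
      rcases le_total d t with h | h
      · have : δ = d := min_eq_left h
        linarith
      · have : δ = t := min_eq_right h
        have h2 : a = 0 := by rw [ha, this, sub_self]
        rw [h2]
        exact Finset.sum_nonneg fun i _ =>
          div_nonneg (by positivity) (mul_nonneg (by norm_num) (logSharp_pos _).le)
    have hcompare := energy_le_mul G ϱ x₀ U F (w := w) (w' := fun r => gaussianWeight R δ a r t)
      (c := 2) hwc (continuous_gaussianWeight R δ a continuous_id continuous_const) (fun r => by
        rcases le_or_gt R r with h | h
        · rw [hw r h]
          exact mul_nonneg zero_le_two (gaussianWeight_nonneg ..)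
        · have := half_le_gaussianWeight (a := a) (t := t) hR3 hδ0 hδ1 h.le
          linarith [hw1 r]) t
    have h94 : 8 / R ^ 2 ≤ 8 / 4 ^ j := by
      rw [hR2]
      gcongr
      norm_num
    -- The bound reproduces itself: the factor 2 lost in comparing `w` with the Gaussian weight is
    -- beaten by the gain 4 per scale.
    have h4 : (32 : ℝ) / 4 ^ j = 2 * (32 / 4 ^ (j + 1) + 8 / 4 ^ j) := by
      rw [pow_succ]
      field_simp
      norm_num
    linarith

/-- A maximum principle: under the volume growth condition there are no functions bounded above
that are uniformly subharmonic near their supremum. -/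
theorem le_neg_one_of_subharmonic {G : WeightedGraph X} {ϱ : X → X → ℝ}
    (hϱ : G.IsIntrinsicMetric ϱ) (hfin : ∀ (x : X) (r : ℝ), (ball ϱ x r).Finite)
    (x₀ : X) {U : X → ℝ} (hU0 : ∀ x, U x ≤ 0)
    (hU : ∀ x, -1 < U x → ∀ F : Finset X, (∀ y, ϱ x y ≤ 1 → y ∈ F) →
      2 * G.m x ≤ ∑ y ∈ F, G.shortWeight ϱ x y * (U y - U x))
    {v : ℕ → ℝ} (hv0 : ∀ i, 0 ≤ v i)
    (hv : ∀ i, ∀ F : Finset X, (∀ x ∈ F, ϱ x x₀ ≤ 3 ^ i) → ∑ x ∈ F, G.m x ≤ v i)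
    (hdiv : ¬ Summable fun i : ℕ => (9 : ℝ) ^ i / (8 * logSharp (v (i + 2)))) (x : X) :
    U x ≤ -1 := by
  have hterm : ∀ i, 0 ≤ (9 : ℝ) ^ i / (8 * logSharp (v (i + 2))) := fun i =>
    div_nonneg (by positivity) (mul_nonneg (by norm_num) (logSharp_pos _).le)
  have hbound : ∀ j : ℕ, 1 ≤ j → ϱ x x₀ + 1 ≤ 3 ^ j →
      G.m x * (max (U x + 1) 0) ^ 4 ≤ 32 / 4 ^ j := by
    intro j hj hxj
    have hdiv' : ¬ Summable fun i : ℕ => (9 : ℝ) ^ (i + j) / (8 * logSharp (v (i + j + 2))) :=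
      fun h => hdiv ((summable_nat_add_iff j).1 h)
    rw [not_summable_iff_tendsto_nat_atTop_of_nonneg fun i => hterm (i + j)] at hdiv'
    obtain ⟨n, hn⟩ := (hdiv'.eventually_ge_atTop 1).exists
    -- One finite ball contains the supports met in all `n` steps, so every energy is a finite sum.
    have hF : ∀ y, ϱ y x₀ ≤ 3 ^ (j + n + 1) → y ∈ (hfin x₀ (3 ^ (j + n + 1))).toFinset :=
      fun y hy => (Set.Finite.mem_toFinset _).2 hy
    have h1 := energy_le_of_le_sum hϱ x₀ hU0 hU hv0 hv n j 1 hj zero_le_one le_rfl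
      (hn.trans_eq (Finset.sum_congr rfl fun i _ => by rw [add_comm i j])) _ hF
      (fun r => max 0 (min 1 (3 ^ j - r))) (by fun_prop)
      (fun r => max_le zero_le_one (min_le_left _ _))
      (fun r hr => max_eq_left ((min_le_right _ _).trans (by linarith)))
    have h2 := G.le_energy ϱ x₀ U (w := fun r => max 0 (min 1 (3 ^ j - r)))
      (fun r => le_max_left _ _) 1 (hF x (by
        have : (3 : ℝ) ^ j ≤ 3 ^ (j + n + 1) := pow_le_pow_right₀ (by norm_num) (by omega)
        linarith))
    have h3 : max 0 (min 1 (3 ^ j - ϱ x x₀)) = 1 := by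
      rw [min_eq_left (by linarith), max_eq_right zero_le_one]
    simp only [h3, mul_one] at h2
    exact h2.trans h1
  have hlim : Tendsto (fun j : ℕ => (32 : ℝ) / 4 ^ j) atTop (nhds 0) :=
    tendsto_const_nhds.div_atTop (tendsto_pow_atTop_atTop_of_one_lt (by norm_num))
  have hle : G.m x * (max (U x + 1) 0) ^ 4 ≤ 0 := by
    refine ge_of_tendsto hlim ?_
    filter_upwards [eventually_ge_atTop 1, (tendsto_pow_atTop_atTop_of_one_lt
      (by norm_num : (1 : ℝ) < 3)).eventually_ge_atTop (ϱ x x₀ + 1)] with j h1 h2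
    exact hbound j h1 h2
  by_contra! h
  have : 0 < G.m x * (max (U x + 1) 0) ^ 4 :=
    mul_pos (G.m_pos x) (pow_pos (lt_max_of_lt_left (by linarith)) 4)
  linarith

/-! ### From the maximum principle to the Liouville property -/

/-- Bounded solutions of the resolvent equation vanish if there are no functions bounded above
that are uniformly subharmonic near their supremum. -/
theorem eq_zero_of_resolvent {G : WeightedGraph X} {ϱ : X → X → ℝ} (hϱ : G.IsIntrinsicMetric ϱ)
    (hmax : ∀ U : X → ℝ, (∀ x, U x ≤ 0) →
      (∀ x, -1 < U x → ∀ F : Finset X, (∀ y, ϱ x y ≤ 1 → y ∈ F) →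
        2 * G.m x ≤ ∑ y ∈ F, G.shortWeight ϱ x y * (U y - U x)) → ∀ x, U x ≤ -1)
    (u : X → ℝ) (hu0 : ∀ x, 0 ≤ u x) (hu1 : ∀ x, u x ≤ 1)
    (hu : ∀ x, ∑' y, G.b x y * (u y - u x) = G.m x * u x) (x : X) : u x = 0 := by
  have : Nonempty X := ⟨x⟩
  have hbdd : BddAbove (Set.range u) := ⟨1, by rintro _ ⟨y, rfl⟩; exact hu1 y⟩
  set S := ⨆ y, u y with hS
  have hle : ∀ y, u y ≤ S := fun y => le_ciSup hbdd y
  by_contra hne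
  have hSpos : 0 < S := lt_of_lt_of_le (lt_of_le_of_ne (hu0 x) (Ne.symm hne)) (hle x)
  obtain ⟨z, hz⟩ := exists_lt_of_lt_ciSup (show 3 / 4 * S < ⨆ y, u y by rw [← hS]; linarith)
  have hscale : ∀ y, -1 < 4 * (u y - S) / S ↔ 3 / 4 * S < u y := by
    intro y
    rw [lt_div_iff₀ hSpos]
    constructor <;> intro h <;> linarith
  refine absurd ((hscale z).2 hz) (not_lt.2 (hmax (fun y => 4 * (u y - S) / S) (fun y => ?_)
    (fun y hy F hF => ?_) z))
  · exact div_nonpos_of_nonpos_of_nonneg (by linarith [hle y]) hSpos.le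
  · have hy' := (hscale y).1 hy
    have hm := G.m_pos y
    have hsum : Summable fun z => G.b y z * (u z - u y) := by
      refine Summable.of_norm_bounded (G.b_summable y) fun z => ?_
      rw [Real.norm_eq_abs, abs_mul, abs_of_nonneg (G.b_nonneg y z)]
      refine mul_le_of_le_one_right (G.b_nonneg y z) (abs_le.2 ⟨?_, ?_⟩) <;>
        linarith [hu0 z, hu0 y, hu1 z, hu1 y]
    have hzero : ∀ z ∉ F, G.shortWeight ϱ y z * (u z - u y) = 0 := by
      intro z hz
      rw [shortWeight, if_neg fun h => hz (hF z h), zero_mul]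
    have hshort : Summable fun z => G.shortWeight ϱ y z * (u z - u y) :=
      summable_of_ne_finset_zero hzero
    -- On a long edge `ϱ² ≥ 1` and `u z ≤ S`. Summing leaves at least `m y (2 u y - S) ≥ m y S / 2`
    -- on the short edges, because `u y > 3S/4`.
    have hpt : ∀ z, G.b y z * (u z - u y) ≤
        G.shortWeight ϱ y z * (u z - u y) + G.b y z * ϱ y z ^ 2 * (S - u y) := by
      intro z
      have h1 : 0 ≤ S - u y := by linarith [hle y]
      unfold shortWeight
      split_ifs with h
      · have := mul_nonneg (mul_nonneg (G.b_nonneg y z) (sq_nonneg (ϱ y z))) h1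
        linarith
      · rw [zero_mul, zero_add, mul_assoc]
        refine mul_le_mul_of_nonneg_left ?_ (G.b_nonneg y z)
        have h2 : 1 ≤ ϱ y z ^ 2 := one_le_pow₀ (by linarith)
        nlinarith [hle z]
    have h1 := hsum.tsum_le_tsum hpt (hshort.add ((hϱ.summable y).mul_right _))
    rw [hu y, hshort.tsum_add ((hϱ.summable y).mul_right _), tsum_mul_right,
      tsum_eq_sum hzero] at h1
    have h2 : (∑' z, G.b y z * ϱ y z ^ 2) * (S - u y) ≤ G.m y * (S - u y) :=
      mul_le_mul_of_nonneg_right (hϱ.tsum_le y) (by linarith [hle y])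
    have h3 : ∑ z ∈ F, G.shortWeight ϱ y z * (4 * (u z - S) / S - 4 * (u y - S) / S) =
        4 / S * ∑ z ∈ F, G.shortWeight ϱ y z * (u z - u y) := by
      rw [Finset.mul_sum]
      exact Finset.sum_congr rfl fun z _ => by ring
    have h4 : 2 * G.m y = 4 / S * (G.m y * S / 2) := by
      field_simp
      norm_num
    rw [h3, h4]
    refine mul_le_mul_of_nonneg_left ?_ (by positivity)
    nlinarith

/-! ### Volume growth and the divergent series -/

theorem volumeGrowth_eq_sum (G : WeightedGraph X) {ϱ : X → X → ℝ} {x₀ : X} {r : ℝ}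
    (hfin : (ball ϱ x₀ r).Finite) :
    G.volumeGrowth ϱ x₀ r = ∑ x ∈ hfin.toFinset, G.m x := by
  unfold volumeGrowth measure
  rw [show ∑' x : ball ϱ x₀ r, ENNReal.ofReal (G.m x) =
      ∑ x ∈ hfin.toFinset, ENNReal.ofReal (G.m x) by
    rw [← Finset.tsum_subtype' hfin.toFinset (fun x => ENNReal.ofReal (G.m x)),
      hfin.coe_toFinset], ENNReal.toReal_sum fun _ _ => ENNReal.ofReal_ne_top]
  exact Finset.sum_congr rfl fun x _ => ENNReal.toReal_ofReal (G.m_pos x).le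

theorem sum_le_volumeGrowth (G : WeightedGraph X) {ϱ : X → X → ℝ} {x₀ : X} {r : ℝ}
    (hfin : (ball ϱ x₀ r).Finite) (F : Finset X) (hF : ∀ x ∈ F, ϱ x x₀ ≤ r) :
    ∑ x ∈ F, G.m x ≤ G.volumeGrowth ϱ x₀ r := by
  rw [G.volumeGrowth_eq_sum hfin]
  exact Finset.sum_le_sum_of_subset_of_nonneg
    (fun x hx => hfin.mem_toFinset.2 (hF x hx)) fun x _ _ => (G.m_pos x).le

theorem volumeGrowth_mono (G : WeightedGraph X) {ϱ : X → X → ℝ} {x₀ : X}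
    (hfin : ∀ r, (ball ϱ x₀ r).Finite) : Monotone (G.volumeGrowth ϱ x₀) := by
  intro r r' hr
  rw [G.volumeGrowth_eq_sum (hfin r)]
  exact G.sum_le_volumeGrowth (hfin r') _
    fun x hx => ((hfin r).mem_toFinset.1 hx : ϱ x x₀ ≤ r).trans hr

/-- The discrete form, over the scales `3 ^ i`, of the divergence of the integral of `r / log V`. -/
theorem not_summable_of_lintegral_eq_top {V : ℝ → ℝ} (hV0 : ∀ r, 0 ≤ V r) (hV : Monotone V)
    (hint : ∫⁻ r in Set.Ioi (0 : ℝ), ENNReal.ofReal (r / logSharp (V r)) = ⊤) :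
    ¬ Summable fun i : ℕ => (9 : ℝ) ^ i / (8 * logSharp (V (3 ^ (i + 2)))) := by
  intro hsum
  have hmono : Monotone fun r => logSharp (V r) := by
    intro r r' hr
    refine max_le ?_ (le_max_right _ _)
    rcases (hV0 r).eq_or_lt with h | h
    · rw [← h, Real.log_zero]
      exact (logSharp_pos _).le
    · exact (Real.log_le_log h (hV hr)).trans (le_max_left _ _)
  have hpiece : ∀ (p q C : ℝ), (∀ r ∈ Set.Icc p q, r / logSharp (V r) ≤ C) →
      ∫⁻ r in Set.Icc p q, ENNReal.ofReal (r / logSharp (V r)) ≤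
        ENNReal.ofReal C * ENNReal.ofReal (q - p) := by
    intro p q C h
    calc _ ≤ ∫⁻ _ in Set.Icc p q, ENNReal.ofReal C :=
          setLIntegral_mono' measurableSet_Icc fun r hr => ENNReal.ofReal_le_ofReal (h r hr)
      _ = _ := by rw [setLIntegral_const, Real.volume_Icc]
  have hcover : Set.Ioi (0 : ℝ) ⊆
      Set.Icc 0 9 ∪ ⋃ i : ℕ, Set.Icc ((3 : ℝ) ^ (i + 2)) (3 ^ (i + 3)) := by
    intro r hr
    rcases le_or_gt r 9 with h | h
    · exact Or.inl ⟨le_of_lt hr, h⟩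
    · right
      obtain ⟨n, hn1, hn2⟩ := exists_nat_pow_near (show 1 ≤ r / 9 by linarith)
        (by norm_num : (1 : ℝ) < 3)
      refine Set.mem_iUnion.2 ⟨n, ?_, ?_⟩
      · rw [pow_add]
        linarith
      · rw [pow_succ] at hn2
        rw [pow_add]
        linarith
  have hscale : ∀ i : ℕ, ∫⁻ r in Set.Icc ((3 : ℝ) ^ (i + 2)) (3 ^ (i + 3)),
      ENNReal.ofReal (r / logSharp (V r)) ≤
        -- On this interval `r ≤ 27 · 3^i`, the length is `18 · 3^i`, and the denominator is
        -- smallest at the left end.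
        ENNReal.ofReal (8 * 27 * 18 * (9 ^ i / (8 * logSharp (V (3 ^ (i + 2)))))) := by
    intro i
    refine (hpiece _ _ (3 ^ (i + 3) / logSharp (V (3 ^ (i + 2)))) fun r hr => ?_).trans
      (le_of_eq ?_)
    · have := logSharp_pos (V (3 ^ (i + 2)))
      exact div_le_div₀ (by positivity) hr.2 this (hmono hr.1)
    · have := logSharp_pos (V (3 ^ (i + 2)))
      rw [← ENNReal.ofReal_mul (by positivity)]
      congr 1
      have h9 : (9 : ℝ) ^ i = 3 ^ i * 3 ^ i := by rw [← mul_pow]; norm_num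
      rw [h9]
      field_simp
      ring
  have hfirst : ∫⁻ r in Set.Icc (0 : ℝ) 9, ENNReal.ofReal (r / logSharp (V r)) < ⊤ := by
    refine (hpiece 0 9 9 fun r hr => ?_).trans_lt
      (ENNReal.mul_lt_top ENNReal.ofReal_lt_top ENNReal.ofReal_lt_top)
    exact (div_le_self hr.1 (le_max_right _ _)).trans hr.2
  have htail : ∑' i : ℕ, ENNReal.ofReal (8 * 27 * 18 * ((9 : ℝ) ^ i /
      (8 * logSharp (V (3 ^ (i + 2)))))) < ⊤ := by
    have := (hsum.mul_left (8 * 27 * 18)).tsum_ofReal_lt_top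
    exact this
  have htotal : ∫⁻ r in Set.Ioi (0 : ℝ), ENNReal.ofReal (r / logSharp (V r)) < ⊤ := by
    calc _ ≤ ∫⁻ r in Set.Icc 0 9 ∪ ⋃ i : ℕ, Set.Icc ((3 : ℝ) ^ (i + 2)) (3 ^ (i + 3)),
          ENNReal.ofReal (r / logSharp (V r)) := lintegral_mono_set hcover
      _ ≤ _ := lintegral_union_le _ _ _
      _ ≤ _ := add_le_add le_rfl ((lintegral_iUnion_le _ _).trans (ENNReal.tsum_le_tsum hscale))
      _ < ⊤ := ENNReal.add_lt_top.2 ⟨hfirst, htail⟩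
  exact htotal.ne hint

end WeightedGraph

theorem theoremt {X : Type*} [Countable X] [Infinite X] (G : WeightedGraph X)
    (ϱ : X → X → ℝ) (hϱ : G.IsIntrinsicMetric ϱ)
    (hfin : ∀ (x : X) (r : ℝ), (WeightedGraph.ball ϱ x r).Finite)
    (x₀ : X)
    (hvol : ∫⁻ r in Set.Ioi (0 : ℝ),
      ENNReal.ofReal (r / WeightedGraph.logSharp (G.volumeGrowth ϱ x₀ r)) = ⊤) :
    G.StochasticallyComplete :=
  G.stochasticallyComplete_of_liouville fun u hu0 hu1 hu =>
    WeightedGraph.eq_zero_of_resolvent hϱ (fun _ hU0 hU =>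
      WeightedGraph.le_neg_one_of_subharmonic hϱ hfin x₀ hU0 hU
        (v := fun i => G.volumeGrowth ϱ x₀ (3 ^ i)) (fun _ => ENNReal.toReal_nonneg)
        (fun _ F hF => G.sum_le_volumeGrowth (hfin x₀ _) F hF)
        (WeightedGraph.not_summable_of_lintegral_eq_top (fun _ => ENNReal.toReal_nonneg)
          (G.volumeGrowth_mono (hfin x₀)) hvol)) u hu0 hu1 hu
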